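/- **Setting.** Let $\mathcal B$ be a $C^*$-algebra (not necessarily unital). A $C^*$-correspondence $E$ over $\mathcal B$ is a (complete) right Hilbert $\mathcal B$-module with a left action of $\mathcal B$ by adjointable operators; $E\otimes F$ is the interior tensor product over $\mathcal B$. Fix a product system $\mathbb E$ over $\mathbb N_0^k$, i.e. $C^*$-correspondences $E_1,\dots,E_k$ over $\mathcal B$ with unitary isomorphisms of correspondences $t_{i,j}:E_i\otimes E_j\to E_j\otimes E_i$ such that $t_{i,i}=\mathrm{id}$ and $t_{j,i}=t_{i,j}^{-1}$. For a representation $\sigma$ of $\mathcal B$ on a Hilbert space $\mathcal H$, let $E_i\otimes_\sigma\mathcal H$ be the Hilbert space obtained from the algebraic tensor product with $\langle\xi\otimes h,\xi'\otimes h'\rangle=\langle h,\sigma(\langle\xi,\xi'\rangle)h'\rangle$; $\mathcal B$ is represented on it through its left action on $E_i$. For a bounded operator $X$ intertwining representations, $I_{E_i}\otimes X$ is the induced operator $\xi\otimes h\mapsto\xi\otimes Xh$. The operator $t_{i,j}\otimes I_{\mathcal H}:E_i\otimes(E_j\otimes_\sigma\mathcal H)\to E_j\otimes(E_i\otimes_\sigma\mathcal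 H)$ is formed after the canonical identification $(E_i\otimes E_j)\otimes_\sigma\mathcal H=E_i\otimes(E_j\otimes_\sigma\mathcal H)$. A completely bounded covariant representation $(\sigma,V^{(1)},\dots,V^{(k)})$ of $\mathbb E$ on $\mathcal H$ consists of a representation $\sigma$ of $\mathcal B$ on $\mathcal H$ and linear maps $V^{(i)}:E_i\to B(\mathcal H)$ with $V^{(i)}(a\xi)=\sigma(a)V^{(i)}(\xi)$ and $V^{(i)}(\xi b)=V^{(i)}(\xi)\sigma(b)$ for $a,b\in\mathcal B$, such that $\xi\otimes h\mapsto V^{(i)}(\xi)h$ extends to a bounded operator $\widetilde V^{(i)}:E_i\otimes_\sigma\mathcal H\to\mathcal H$, and $$\widetilde V^{(i)}(I_{E_i}\otimes\widetilde V^{(j)})=\widetilde V^{(j)}(I_{E_j}\otimes\widetilde V^{(i)})(t_{i,j}\otimes I_{\mathcal H})\qquad(1\le i,j\le k).$$ It is *doubly commuting isometric* if every $\widetilde V^{(i)}$ is an isometry and $$\widetilde V^{(j)*}\widetilde V^{(i)}=(I_{E_j}\otimes\widetilde V^{(i)})(t_{i,j}\otimes I_{\mathcal H})(I_{E_i}\otimes\widetilde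 V^{(j)*})\qquad(i\ne j).$$ It is *pure* if for every $i$ one has $\widetilde V^{(i)}_n\widetilde V^{(i)*}_n\to0$ strongly as $n\to\infty$, where $\widetilde V^{(i)}_0=I_{\mathcal H}$ and $\widetilde V^{(i)}_{n+1}=\widetilde V^{(i)}(I_{E_i}\otimes\widetilde V^{(i)}_n)$. A closed subspace $\mathcal K\subseteq\mathcal H$ is a *quotient subspace* if $\sigma(\mathcal B)\mathcal K\subseteq\mathcal K$ and $\widetilde V^{(i)*}\mathcal K\subseteq E_i\otimes\mathcal K$ for all $i$, where $E_i\otimes\mathcal K$ is the closed linear span of $\{\xi\otimes h:\xi\in E_i,\ h\in\mathcal K\}$. It is a *Beurling quotient subspace* if there are a Hilbert space $\mathcal H_W$, a pure doubly commuting isometric representation $(\pi,W^{(1)},\dots,W^{(k)})$ of $\mathbb E$ on $\mathcal H_W$ and an isometry $M:\mathcal H_W\to\mathcal H$ that is multi-analytic, i.e. $MW^{(i)}(\xi)=V^{(i)}(\xi)M$ for all $i$ and $\xi\in E_i$, and $M\pi(a)=\sigma(a)M$ for all $a\in\mathcal B$, such that $\mathcal K=\mathcal H\ominus M\mathcal H_W$.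 **Theorem.** Let $(\sigma,V^{(1)},\dots,V^{(k)})$ be a pure doubly commuting isometric representation of $\mathbb E$ on $\mathcal H$, and let $\mathcal K$ be a quotient subspace of $\mathcal H$ with orthogonal projection $P_{\mathcal K}$. Put $\widetilde T^{(i)}=P_{\mathcal K}\widetilde V^{(i)}(I_{E_i}\otimes P_{\mathcal K})$. Then $\mathcal K$ is a Beurling quotient subspace if and only if for all $i\neq j$ in $\{1,\dots,k\}$ $$\bigl(I_{E_j}\otimes((I_{E_i}\otimes P_{\mathcal K})-\widetilde T^{(i)*}\widetilde T^{(i)})\bigr)(t_{i,j}\otimes I_{\mathcal H})\bigl(I_{E_i}\otimes((I_{E_j}\otimes P_{\mathcal K})-\widetilde T^{(j)*}\widetilde T^{(j)})\bigr)=0.$$ -/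

import Mathlib

open scoped TensorProduct ComplexOrder

noncomputable section

universe u v w

theorem exists_test_element {M : Type*} [NonUnitalCStarAlgebra M] [PartialOrder M]
    [StarOrderedRing M] (G : M) (hG : IsSelfAdjoint G) :
    ∃ N : M, star N = N ∧ (∃ s, N * N * N = star s * s) ∧ N * G * N = -(N * N * N) ∧
      (N * N * N = 0 → ∃ c, G = star c * c) := by
  have hN0 : 0 ≤ G⁻ := CFC.negPart_nonneg G
  have hNs : star G⁻ = G⁻ := (IsSelfAdjoint.of_nonneg hN0).star_eq
  refine ⟨G⁻, hNs, ?_, ?_, ?_⟩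
  · refine CStarAlgebra.nonneg_iff_eq_star_mul_self.mp ?_
    simpa [hNs] using star_left_conjugate_nonneg hN0 G⁻
  · have : G⁻ * G = -(G⁻ * G⁻) := by
      calc G⁻ * G = G⁻ * (G⁺ - G⁻) := by rw [CFC.posPart_sub_negPart G hG]
        _ = _ := by rw [mul_sub, CFC.negPart_mul_posPart, zero_sub]
    rw [this, neg_mul]
  · intro h3
    have h4 : star (G⁻ * G⁻) * (G⁻ * G⁻) = 0 := by
      rw [star_mul, hNs, ← mul_assoc, h3, zero_mul]
    have h2 : star G⁻ * G⁻ = 0 := by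
      rw [hNs]; exact CStarRing.star_mul_self_eq_zero_iff _ |>.mp h4
    have h1 := CStarRing.star_mul_self_eq_zero_iff _ |>.mp h2
    refine CStarAlgebra.nonneg_iff_eq_star_mul_self.mp ?_
    rw [← CFC.posPart_sub_negPart G hG, h1, sub_zero]
    exact CFC.posPart_nonneg G

/-- A complex vector space `X` with a `D`-valued semi-inner product (conjugate-linear in the first
variable), a right action of `D` (`right d x` is `x · d`) and a left action of `A` by adjointable
operators (`left a x` is `a · x`), for `C⋆`-algebras `A` and `D`. The semi-inner product may
be degenerate and no completeness is required. -/
structure PreCorr (A D X : Type*) [NonUnitalCStarAlgebra A] [NonUnitalCStarAlgebra D]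
    [PartialOrder D] [StarOrderedRing D] [AddCommGroup X] [Module ℂ X] where
  inner : X →ₗ⋆[ℂ] X →ₗ[ℂ] D
  right : D →ₗ[ℂ] X →ₗ[ℂ] X
  left : A →ₗ[ℂ] X →ₗ[ℂ] X
  star_inner : ∀ x y, star (inner x y) = inner y x
  inner_self_nonneg : ∀ x, 0 ≤ inner x x
  inner_right : ∀ x y d, inner x (right d y) = inner x y * d
  right_mul : ∀ d e x, right (d * e) x = right e (right d x)
  left_mul : ∀ a b x, left (a * b) x = left a (left b x)
  inner_left : ∀ a x y, inner (left a x) y = inner x (left (star a) y)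
  left_right : ∀ a d x, left a (right d x) = right d (left a x)

namespace PreCorr

variable {A D X : Type*} [NonUnitalCStarAlgebra A] [NonUnitalCStarAlgebra D]
    [PartialOrder D] [StarOrderedRing D] [AddCommGroup X] [Module ℂ X] (P : PreCorr A D X)

theorem inner_right_left (x y : X) (d : D) : P.inner (P.right d x) y = star d * P.inner x y := by
  rw [← P.star_inner, P.inner_right, star_mul, P.star_inner]

theorem norm_inner_sq_le (x y : X) :
    ‖P.inner x y‖ ^ 2 ≤ ‖P.inner x x‖ * ‖P.inner y y‖ := by
  have key : ∀ t : ℝ, 0 < t → ‖P.inner x x‖ ≤ t → ‖P.inner x y‖ ^ 2 ≤ t * ‖P.inner y y‖ := by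
    intro t ht hxt
    set a := P.inner x y with ha
    have h0 := P.inner_self_nonneg ((t : ℂ) • y - P.right a x)
    have hya : P.inner y x = star a := by rw [ha, P.star_inner]
    have e1 : P.inner ((t : ℂ) • y - P.right a x) ((t : ℂ) • y - P.right a x)
        = (t ^ 2 : ℝ) • P.inner y y - (2 * t) • (star a * a) + star a * P.inner x x * a := by
      simp only [map_sub, LinearMap.sub_apply, map_smul, LinearMap.map_smulₛₗ, LinearMap.smul_apply,
        P.inner_right, P.inner_right_left, hya, ← ha, mul_assoc]
      simp only [Complex.conj_ofReal, Complex.coe_smul]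
      module
    rw [e1] at h0
    have h1 : star a * P.inner x x * a ≤ t • (star a * a) := by
      refine (CStarAlgebra.star_left_conjugate_le_norm_smul
        (IsSelfAdjoint.of_nonneg (P.inner_self_nonneg x))).trans ?_
      exact smul_le_smul_of_nonneg_right hxt (star_mul_self_nonneg a)
    have h2 : t • (star a * a) ≤ (t ^ 2 : ℝ) • P.inner y y := by
      rw [← sub_nonneg]
      refine h0.trans ?_
      rw [← sub_nonneg] at h1 ⊢
      convert h1 using 1
      module
    have h3 := CStarAlgebra.norm_le_norm_of_nonneg_of_le
      (smul_nonneg ht.le (star_mul_self_nonneg a)) h2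
    rw [norm_smul, norm_smul, CStarRing.norm_star_mul_self, Real.norm_of_nonneg ht.le,
      Real.norm_of_nonneg (by positivity)] at h3
    have : t * ‖a‖ ^ 2 ≤ t * (t * ‖P.inner y y‖) := by nlinarith
    exact le_of_mul_le_mul_left this ht
  by_contra! hlt
  have hc : Filter.Tendsto (fun t : ℝ => t * ‖P.inner y y‖)
      (nhdsWithin ‖P.inner x x‖ (Set.Ioi ‖P.inner x x‖))
      (nhds (‖P.inner x x‖ * ‖P.inner y y‖)) :=
    ((continuous_id.mul continuous_const).tendsto _).mono_left nhdsWithin_le_nhds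
  refine absurd (ge_of_tendsto hc ?_) (not_le.mpr hlt)
  filter_upwards [self_mem_nhdsWithin] with t ht
  exact key t (lt_of_le_of_lt (norm_nonneg _) ht) (le_of_lt ht)

theorem inner_eq_zero_left {x : X} (h : P.inner x x = 0) (y : X) : P.inner x y = 0 := by
  have := P.norm_inner_sq_le x y
  rw [h, norm_zero, zero_mul] at this
  exact norm_eq_zero.mp (pow_eq_zero_iff (two_ne_zero) |>.mp (le_antisymm this (sq_nonneg _)))

theorem exists_gram_factor {ι : Type*} [Fintype ι] (x : ι → X) :
    ∃ c : ι → ι → D, ∀ i j, P.inner (x i) (x j) = ∑ k, star (c k i) * c k j := by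
  classical
  let G : CStarMatrix ι ι D := CStarMatrix.ofMatrix fun i j => P.inner (x i) (x j)
  have hG : IsSelfAdjoint G := by
    ext i j
    exact P.star_inner _ _
  obtain ⟨N, hNs, ⟨s, hs⟩, hGN, hfac⟩ := exists_test_element G hG
  let z : ι → X := fun k => ∑ i, P.right (N i k) (x i)
  have hz : ∀ k l, (N * G * N) k l = P.inner (z k) (z l) := by
    intro k l
    have hst : ∀ i, N k i = star (N i k) := fun i => by
      conv_lhs => rw [← hNs]
      rfl
    simp only [z, map_sum, LinearMap.sum_apply, P.inner_right, P.inner_right_left,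
      CStarMatrix.mul_apply, Finset.sum_mul, hst]
    rfl
  have hzz : ∀ k, P.inner (z k) (z k) = 0 := by
    intro k
    refine le_antisymm ?_ (P.inner_self_nonneg _)
    rw [← hz, hGN, hs, CStarMatrix.neg_apply, CStarMatrix.mul_apply, neg_nonpos]
    exact Finset.sum_nonneg fun i _ => star_mul_self_nonneg (s i k)
  have hNG : N * G * N = 0 := by
    ext k l
    rw [hz, P.inner_eq_zero_left (hzz k)]; rfl
  obtain ⟨c, hc⟩ := hfac (by rw [← neg_eq_zero, ← hGN, hNG])
  refine ⟨fun k i => c k i, fun i j => ?_⟩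
  change G i j = _
  rw [hc, CStarMatrix.mul_apply]
  rfl

theorem norm_inner_left_le (a : A) (x : X) :
    ‖P.inner (P.left a x) (P.left a x)‖ ≤ ‖a‖ ^ 2 * ‖P.inner x x‖ := by
  let : PartialOrder (Unitization ℂ A) := CStarAlgebra.spectralOrder _
  let : StarOrderedRing (Unitization ℂ A) := CStarAlgebra.spectralOrderedRing _
  have h := CStarAlgebra.star_mul_le_algebraMap_norm_sq (a := (a : Unitization ℂ A))
  rw [← sub_nonneg] at h
  obtain ⟨d, hd⟩ := CStarAlgebra.nonneg_iff_eq_star_mul_self.mp h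
  let L : Unitization ℂ A → X → X := fun c y => c.fst • y + P.left c.snd y
  have hL : ∀ c y z, P.inner (L c y) z = P.inner y (L (star c) z) := by
    intro c y z
    simp [L, P.inner_left]
  have hmul : ∀ b c y, L b (L c y) = L (b * c) y := by
    intro b c y
    simp only [L, Unitization.fst_mul, Unitization.snd_mul, map_add, map_smul, LinearMap.add_apply,
      LinearMap.smul_apply, P.left_mul, smul_add, mul_smul]
    abel
  have h0 := P.inner_self_nonneg (L d x)
  rw [hL, hmul, ← hd] at h0
  have e : L (algebraMap ℝ (Unitization ℂ A) (‖(a : Unitization ℂ A)‖ ^ 2) - star (a : Unitization ℂ A) * a) x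
      = ((‖a‖ ^ 2 : ℝ) : ℂ) • x - P.left (star a) (P.left a x) := by
    have h1 : (algebraMap ℝ (Unitization ℂ A) (‖a‖ ^ 2)) = Unitization.inl ((‖a‖ ^ 2 : ℝ) : ℂ) := rfl
    simp only [Unitization.norm_inr]
    rw [h1]
    simp only [L]
    simp [← P.left_mul, sub_eq_add_neg]
  rw [e, map_sub, map_smul, ← P.inner_left, sub_nonneg] at h0
  have := CStarAlgebra.norm_le_norm_of_nonneg_of_le (P.inner_self_nonneg _) h0
  rwa [norm_smul, Complex.norm_real, Real.norm_of_nonneg (by positivity)] at this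

theorem norm_inner_right_le (d : D) (x : X) :
    ‖P.inner (P.right d x) (P.right d x)‖ ≤ ‖d‖ ^ 2 * ‖P.inner x x‖ := by
  rw [P.inner_right, P.inner_right_left]
  calc _ ≤ ‖star d‖ * ‖P.inner x x‖ * ‖d‖ :=
        (norm_mul_le _ _).trans (by gcongr; exact norm_mul_le _ _)
    _ = _ := by rw [norm_star]; ring

theorem seminormCore : letI : Norm X := ⟨fun x => √‖P.inner x x‖⟩; SeminormedSpace.Core ℂ X := by
  let : Norm X := ⟨fun x => √‖P.inner x x‖⟩
  have hn : ∀ x : X, ‖x‖ = √‖P.inner x x‖ := fun _ => rfl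
  have hsq : ∀ x : X, ‖x‖ ^ 2 = ‖P.inner x x‖ := fun x => by rw [hn, Real.sq_sqrt (norm_nonneg _)]
  have h0 : ∀ x : X, 0 ≤ ‖x‖ := fun x => Real.sqrt_nonneg _
  have hcs : ∀ x y : X, ‖P.inner x y‖ ≤ ‖x‖ * ‖y‖ := fun x y => by
    refine abs_le_of_sq_le_sq' ?_ (mul_nonneg (h0 x) (h0 y)) |>.2
    rw [mul_pow, hsq, hsq]; exact P.norm_inner_sq_le x y
  refine ⟨h0, fun c x => ?_, fun x y => ?_⟩
  · rw [hn, hn, map_smul, LinearMap.map_smulₛₗ, LinearMap.smul_apply, norm_smul, norm_smul,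
      RCLike.norm_conj, ← mul_assoc, Real.sqrt_mul (by positivity),
      Real.sqrt_mul_self (norm_nonneg _)]
  · refine abs_le_of_sq_le_sq' ?_ (add_nonneg (h0 x) (h0 y)) |>.2
    rw [hsq, map_add, map_add, LinearMap.add_apply, LinearMap.add_apply]
    calc _ ≤ (‖P.inner x x‖ + ‖P.inner y x‖) + (‖P.inner x y‖ + ‖P.inner y y‖) :=
          (norm_add_le _ _).trans (add_le_add (norm_add_le _ _) (norm_add_le _ _))
      _ ≤ (‖x‖ ^ 2 + ‖y‖ * ‖x‖) + (‖x‖ * ‖y‖ + ‖y‖ ^ 2) := by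
          rw [hsq, hsq]; gcongr <;> exact hcs _ _
      _ = _ := by ring

/-- The space `X` carrying the seminorm `‖⟨x, x⟩‖ ^ (1 / 2)`. -/
def Space (_ : PreCorr A D X) : Type _ := X

instance : AddCommGroup P.Space := inferInstanceAs (AddCommGroup X)

instance : Module ℂ P.Space := inferInstanceAs (Module ℂ X)

instance : Norm P.Space := ⟨fun x => √‖P.inner x x‖⟩

theorem seminormCore_space : SeminormedSpace.Core ℂ P.Space := P.seminormCore

instance : SeminormedAddCommGroup P.Space := SeminormedAddCommGroup.ofCore P.seminormCore_space

instance : NormedSpace ℂ P.Space where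
  norm_smul_le c x := (P.seminormCore_space.norm_smul c x).le

/-- The identity map from `X` to its seminormed copy. -/
def toSpace : X →ₗ[ℂ] P.Space where
  toFun x := x
  map_add' _ _ := rfl
  map_smul' _ _ := rfl

/-- The Hausdorff completion of `X` for the seminorm `‖⟨x, x⟩‖ ^ (1 / 2)`. -/
def Hilb : Type _ := UniformSpace.Completion P.Space

instance : NormedAddCommGroup P.Hilb :=
  inferInstanceAs (NormedAddCommGroup (UniformSpace.Completion P.Space))

instance : NormedSpace ℂ P.Hilb :=
  inferInstanceAs (NormedSpace ℂ (UniformSpace.Completion P.Space))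

instance : CompleteSpace P.Hilb :=
  inferInstanceAs (CompleteSpace (UniformSpace.Completion P.Space))

/-- The canonical map of `X` into its Hausdorff completion. -/
def emb : X →ₗ[ℂ] P.Hilb :=
  (UniformSpace.Completion.toComplₗᵢ : P.Space →ₗᵢ[ℂ] _).toLinearMap ∘ₗ P.toSpace

theorem denseRange_emb : DenseRange P.emb := UniformSpace.Completion.denseRange_coe (α := P.Space)

theorem norm_emb (x : X) : ‖P.emb x‖ = √‖P.inner x x‖ :=
  (UniformSpace.Completion.toComplₗᵢ : P.Space →ₗᵢ[ℂ] _).norm_map (P.toSpace x)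

theorem norm_emb_sq (x : X) : ‖P.emb x‖ ^ 2 = ‖P.inner x x‖ := by
  rw [norm_emb, Real.sq_sqrt (norm_nonneg _)]

theorem norm_inner_le (x y : X) : ‖P.inner x y‖ ≤ ‖P.emb x‖ * ‖P.emb y‖ := by
  refine abs_le_of_sq_le_sq' ?_ (by positivity) |>.2
  rw [mul_pow, norm_emb_sq, norm_emb_sq]; exact P.norm_inner_sq_le x y

theorem norm_emb_le {Y : Type*} [SeminormedAddCommGroup Y] (x : X) (y : Y) (c : ℝ) (hc : 0 ≤ c)
    (h : ‖P.inner x x‖ ≤ c ^ 2 * ‖y‖ ^ 2) : ‖P.emb x‖ ≤ c * ‖y‖ := by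
  refine abs_le_of_sq_le_sq' ?_ (by positivity) |>.2
  rwa [mul_pow, norm_emb_sq]

/-- The bounded extension to the completion of a linear map on `X` that is bounded with respect to
the seminorm. -/
def lift {Y : Type*} [NormedAddCommGroup Y] [NormedSpace ℂ Y] [CompleteSpace Y] (f : X →ₗ[ℂ] Y) :
    P.Hilb →L[ℂ] Y :=
  f.extendOfNorm P.emb

theorem lift_emb {Y : Type*} [NormedAddCommGroup Y] [NormedSpace ℂ Y] [CompleteSpace Y]
    {f : X →ₗ[ℂ] Y} (hf : ∃ C, ∀ x, ‖f x‖ ≤ C * ‖P.emb x‖) (x : X) : P.lift f (P.emb x) = f x :=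
  LinearMap.extendOfNorm_eq P.denseRange_emb hf x

theorem ext_clm {Y : Type*} [NormedAddCommGroup Y] [NormedSpace ℂ Y] {f g : P.Hilb →L[ℂ] Y}
    (h : ∀ x, f (P.emb x) = g (P.emb x)) : f = g :=
  ContinuousLinearMap.ext fun z => congrFun
    (P.denseRange_emb.equalizer f.continuous g.continuous (funext h)) z

/-- The `D`-valued inner product of the completion with first variable in `X`. -/
def innerHilbAux : X →ₗ⋆[ℂ] P.Hilb →L[ℂ] D where
  toFun x := P.lift (P.inner x)
  map_add' x y := P.ext_clm fun z => by
    rw [add_apply]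
    simp only [P.lift_emb ⟨_, P.norm_inner_le _⟩]; simp
  map_smul' c x := P.ext_clm fun z => by
    rw [smul_apply]
    simp only [P.lift_emb ⟨_, P.norm_inner_le _⟩]; simp

/-- The `D`-valued inner product of the completion. -/
def innerHilb : P.Hilb →L⋆[ℂ] P.Hilb →L[ℂ] D := P.innerHilbAux.extendOfNorm P.emb

theorem innerHilb_emb (x y : X) : P.innerHilb (P.emb x) (P.emb y) = P.inner x y := by
  have h : ∃ C, ∀ x, ‖P.innerHilbAux x‖ ≤ C * ‖P.emb x‖ := ⟨1, fun x => by
    rw [one_mul]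
    exact LinearMap.opNorm_extendOfNorm_le P.denseRange_emb (norm_nonneg _) (P.norm_inner_le x)⟩
  rw [innerHilb, LinearMap.extendOfNorm_eq P.denseRange_emb h]
  exact P.lift_emb ⟨_, P.norm_inner_le x⟩ y

theorem bound_left (a : A) : ∃ C, ∀ x, ‖(P.emb ∘ₗ P.left a) x‖ ≤ C * ‖P.emb x‖ :=
  ⟨‖a‖, fun x => P.norm_emb_le _ _ _ (norm_nonneg a) (by
    rw [norm_emb_sq]; exact P.norm_inner_left_le a x)⟩

theorem bound_right (d : D) : ∃ C, ∀ x, ‖(P.emb ∘ₗ P.right d) x‖ ≤ C * ‖P.emb x‖ :=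
  ⟨‖d‖, fun x => P.norm_emb_le _ _ _ (norm_nonneg d) (by
    rw [norm_emb_sq]; exact P.norm_inner_right_le d x)⟩

/-- The left action of `A` on the completion. -/
def leftHilb : A →ₗ[ℂ] P.Hilb →L[ℂ] P.Hilb where
  toFun a := P.lift (P.emb ∘ₗ P.left a)
  map_add' a b := P.ext_clm fun x => by
    rw [add_apply]; simp only [P.lift_emb (P.bound_left _)]; simp
  map_smul' c a := P.ext_clm fun x => by
    rw [smul_apply]; simp only [P.lift_emb (P.bound_left _)]; simp

theorem leftHilb_emb (a : A) (x : X) : P.leftHilb a (P.emb x) = P.emb (P.left a x) :=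
  P.lift_emb (P.bound_left a) x

/-- The right action of `D` on the completion. -/
def rightHilb : D →ₗ[ℂ] P.Hilb →L[ℂ] P.Hilb where
  toFun d := P.lift (P.emb ∘ₗ P.right d)
  map_add' a b := P.ext_clm fun x => by
    rw [add_apply]; simp only [P.lift_emb (P.bound_right _)]; simp
  map_smul' c a := P.ext_clm fun x => by
    rw [smul_apply]; simp only [P.lift_emb (P.bound_right _)]; simp

theorem rightHilb_emb (d : D) (x : X) : P.rightHilb d (P.emb x) = P.emb (P.right d x) :=
  P.lift_emb (P.bound_right d) x

theorem induction_emb {p : P.Hilb → Prop} (hp : IsClosed {z | p z}) (h : ∀ x, p (P.emb x)) (z) :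
    p z :=
  P.denseRange_emb.induction_on z hp h

theorem induction_emb₂ {p : P.Hilb → P.Hilb → Prop} (hp : IsClosed {z : _ × _ | p z.1 z.2})
    (h : ∀ x y, p (P.emb x) (P.emb y)) (z w) : p z w :=
  P.denseRange_emb.induction_on₂ hp h z w

end PreCorr

/-- A `C⋆`-correspondence from `A` to `D`: a right Hilbert `D`-module `E` (the `D`-valued inner
product induces the norm, and `E` is taken complete wherever a correspondence is used), with a
left action of `A` by adjointable operators. -/
structure Corr (A D E : Type*) [NonUnitalCStarAlgebra A] [NonUnitalCStarAlgebra D]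
    [PartialOrder D] [StarOrderedRing D] [NormedAddCommGroup E] [NormedSpace ℂ E]
    extends PreCorr A D E where
  norm_sq : ∀ x, ‖x‖ ^ 2 = ‖inner x x‖

namespace PreCorr

variable {A D X : Type*} [NonUnitalCStarAlgebra A] [NonUnitalCStarAlgebra D]
    [PartialOrder D] [StarOrderedRing D] [AddCommGroup X] [Module ℂ X] (P : PreCorr A D X)

/-- The correspondence structure of the Hausdorff completion. -/
def completion : Corr A D P.Hilb where
  inner := (ContinuousLinearMap.coeLM ℂ).comp P.innerHilb.toLinearMap
  right := (ContinuousLinearMap.coeLM ℂ) ∘ₗ P.rightHilb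
  left := (ContinuousLinearMap.coeLM ℂ) ∘ₗ P.leftHilb
  star_inner := by
    change ∀ x y, star (P.innerHilb x y) = P.innerHilb y x
    refine P.induction_emb₂ (isClosed_eq (by fun_prop) (by fun_prop)) fun x y => ?_
    simp [innerHilb_emb, P.star_inner]
  inner_self_nonneg := by
    change ∀ x, 0 ≤ P.innerHilb x x
    refine P.induction_emb (CStarAlgebra.isClosed_nonneg.preimage
      (f := fun x => P.innerHilb x x) (by fun_prop)) fun x => ?_
    rw [innerHilb_emb]; exact P.inner_self_nonneg x
  inner_right := by
    change ∀ x y d, P.innerHilb x (P.rightHilb d y) = P.innerHilb x y * d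
    intro x y d
    revert x y
    refine P.induction_emb₂ (isClosed_eq (by fun_prop) (by fun_prop)) fun x y => ?_
    simp [innerHilb_emb, rightHilb_emb, P.inner_right]
  right_mul := by
    change ∀ d e x, P.rightHilb (d * e) x = P.rightHilb e (P.rightHilb d x)
    intro d e
    refine P.induction_emb (isClosed_eq (by fun_prop) (by fun_prop)) fun x => ?_
    simp [rightHilb_emb, P.right_mul]
  left_mul := by
    change ∀ d e x, P.leftHilb (d * e) x = P.leftHilb d (P.leftHilb e x)
    intro d e
    refine P.induction_emb (isClosed_eq (by fun_prop) (by fun_prop)) fun x => ?_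
    simp [leftHilb_emb, P.left_mul]
  inner_left := by
    change ∀ a x y, P.innerHilb (P.leftHilb a x) y = P.innerHilb x (P.leftHilb (star a) y)
    intro a
    refine P.induction_emb₂ (isClosed_eq (by fun_prop) (by fun_prop)) fun x y => ?_
    simp [innerHilb_emb, leftHilb_emb, P.inner_left]
  left_right := by
    change ∀ a d x, P.leftHilb a (P.rightHilb d x) = P.rightHilb d (P.leftHilb a x)
    intro a d
    refine P.induction_emb (isClosed_eq (by fun_prop) (by fun_prop)) fun x => ?_
    simp [leftHilb_emb, rightHilb_emb, P.left_right]
  norm_sq := by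
    change ∀ x, ‖x‖ ^ 2 = ‖P.innerHilb x x‖
    refine P.induction_emb (isClosed_eq (by fun_prop) (by fun_prop)) fun x => ?_
    rw [innerHilb_emb, norm_emb_sq]

theorem completion_inner_emb (x y : X) : P.completion.inner (P.emb x) (P.emb y) = P.inner x y :=
  P.innerHilb_emb x y

theorem completion_left_emb (a : A) (x : X) : P.completion.left a (P.emb x) = P.emb (P.left a x) :=
  P.leftHilb_emb a x

theorem completion_right_emb (d : D) (x : X) : P.completion.right d (P.emb x) = P.emb (P.right d x) :=
  P.rightHilb_emb d x

end PreCorr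

namespace PreCorr

variable {A B D X Y : Type*} [NonUnitalCStarAlgebra A] [NonUnitalCStarAlgebra B]
    [PartialOrder B] [StarOrderedRing B] [NonUnitalCStarAlgebra D]
    [PartialOrder D] [StarOrderedRing D] [AddCommGroup X] [Module ℂ X]
    [AddCommGroup Y] [Module ℂ Y] (P : PreCorr A B X) (Q : PreCorr B D Y)

/-- The `D`-valued semi-inner product on the algebraic tensor product, determined by
`⟨ξ ⊗ η, ξ' ⊗ η'⟩ = ⟨η, ⟨ξ, ξ'⟩ · η'⟩`. -/
def tensorInner : (X ⊗[ℂ] Y) →ₗ⋆[ℂ] (X ⊗[ℂ] Y) →ₗ[ℂ] D :=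
  TensorProduct.lift (LinearMap.mk₂'ₛₗ (starRingEnd ℂ) (starRingEnd ℂ)
    (fun ξ η => TensorProduct.lift ((Q.left ∘ₗ P.inner ξ).compr₂ (Q.inner η)))
    (fun _ _ _ => TensorProduct.ext' fun _ _ => by simp)
    (fun _ _ _ => TensorProduct.ext' fun _ _ => by simp)
    (fun _ _ _ => TensorProduct.ext' fun _ _ => by simp)
    (fun _ _ _ => TensorProduct.ext' fun _ _ => by simp))

theorem tensorInner_tmul (ξ ξ' : X) (η η' : Y) :
    P.tensorInner Q (ξ ⊗ₜ η) (ξ' ⊗ₜ η') = Q.inner η (Q.left (P.inner ξ ξ') η') := by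
  simp [tensorInner]

theorem exists_tensor_sum {X : Type u} {Y : Type v} [AddCommGroup X] [Module ℂ X]
    [AddCommGroup Y] [Module ℂ Y] (u : X ⊗[ℂ] Y) : ∃ (ι : Type (max u v)) (_ : Fintype ι)
    (ξ : ι → X) (η : ι → Y), u = ∑ i, ξ i ⊗ₜ[ℂ] η i := by
  obtain ⟨S, hS⟩ := TensorProduct.exists_finset u
  exact ⟨S, inferInstance, fun i => i.1.1, fun i => i.1.2, by
    rw [hS, ← Finset.sum_coe_sort]⟩

theorem tensorInner_self {ι : Type*} [Fintype ι] {ξ : ι → X} {c : ι → ι → B}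
    (hc : ∀ i j, P.inner (ξ i) (ξ j) = ∑ k, star (c k i) * c k j) (η : ι → Y) :
    P.tensorInner Q (∑ i, ξ i ⊗ₜ[ℂ] η i) (∑ i, ξ i ⊗ₜ[ℂ] η i)
      = ∑ k, Q.inner (∑ i, Q.left (c k i) (η i)) (∑ i, Q.left (c k i) (η i)) := by
  simp only [map_sum, LinearMap.sum_apply, tensorInner_tmul, hc, Q.left_mul, Q.inner_left]
  rw [Finset.sum_congr rfl fun i _ => Finset.sum_comm, Finset.sum_comm]

/-- The algebraic interior tensor product of `P` and `Q`. -/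
def tensor : PreCorr A D (X ⊗[ℂ] Y) where
  inner := P.tensorInner Q
  right := (LinearMap.lTensorHom X) ∘ₗ Q.right
  left := (LinearMap.rTensorHom Y) ∘ₗ P.left
  star_inner x y := by
    induction x with
    | zero => simp
    | add x x' hx hx' => simp [hx, hx']
    | tmul ξ η =>
      induction y with
      | zero => simp
      | add x x' hx hx' => simp [hx, hx']
      | tmul ξ' η' =>
        rw [tensorInner_tmul, tensorInner_tmul, Q.star_inner, Q.inner_left, P.star_inner]
  inner_self_nonneg x := by
    obtain ⟨ι, _, ξ, η, rfl⟩ := exists_tensor_sum x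
    obtain ⟨c, hc⟩ := P.exists_gram_factor ξ
    rw [P.tensorInner_self Q hc]
    exact Finset.sum_nonneg fun _ _ => Q.inner_self_nonneg _
  inner_right x y d := by
    induction x with
    | zero => simp
    | add x x' hx hx' => simp only [map_add, LinearMap.add_apply, hx, hx', add_mul]
    | tmul ξ η =>
      induction y with
      | zero => simp
      | add x x' hx hx' => simp only [map_add, hx, hx', add_mul]
      | tmul ξ' η' => simp [tensorInner_tmul, Q.left_right, Q.inner_right]
  right_mul d e x := by
    induction x with
    | zero => simp
    | add x x' hx hx' => simp only [map_add, hx, hx']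
    | tmul ξ η => simp [Q.right_mul]
  left_mul d e x := by
    induction x with
    | zero => simp
    | add x x' hx hx' => simp only [map_add, hx, hx']
    | tmul ξ η => simp [P.left_mul]
  inner_left a x y := by
    induction x with
    | zero => simp
    | add x x' hx hx' => simp only [map_add, LinearMap.add_apply, hx, hx']
    | tmul ξ η =>
      induction y with
      | zero => simp
      | add x x' hx hx' => simp only [map_add, hx, hx']
      | tmul ξ' η' => simp [tensorInner_tmul, P.inner_left]
  left_right a d x := by
    induction x with
    | zero => simp
    | add x x' hx hx' => simp only [map_add, hx, hx']
    | tmul ξ η => simp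

end PreCorr

/-! ### Representations on Hilbert spaces and intertwining operators -/

/-- A representation of a `C⋆`-algebra `B` on a Hilbert space `H`: a `⋆`-homomorphism from `B` to
the bounded operators on `H`. -/
abbrev HilbertRep (B H : Type*) [NonUnitalCStarAlgebra B] [NormedAddCommGroup H]
    [InnerProductSpace ℂ H] [CompleteSpace H] : Type _ :=
  B →⋆ₙₐ[ℂ] (H →L[ℂ] H)

/-- A Hilbert space with a representation of `B`, viewed as a correspondence from `B` to `ℂ`. -/
def repCorr {B H : Type*} [NonUnitalCStarAlgebra B] [NormedAddCommGroup H]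
    [InnerProductSpace ℂ H] [CompleteSpace H] (σ : HilbertRep B H) : Corr B ℂ H where
  inner := innerₛₗ ℂ
  right := LinearMap.lsmul ℂ H
  left := (ContinuousLinearMap.coeLM ℂ) ∘ₗ (σ : B →ₗ[ℂ] (H →L[ℂ] H))
  star_inner x y := inner_conj_symm y x
  inner_self_nonneg x := by
    rw [innerₛₗ_apply_apply, inner_self_eq_norm_sq_to_K]
    rw [← RCLike.ofReal_pow]
    exact Complex.zero_le_real.mpr (sq_nonneg ‖x‖)
  inner_right x y d := by simp [mul_comm]
  right_mul d e x := by simp [smul_smul]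
  left_mul a b x := by simp
  inner_left a x y := by
    change inner ℂ (σ a x) y = inner ℂ x (σ (star a) y)
    rw [map_star, ContinuousLinearMap.star_eq_adjoint, ContinuousLinearMap.adjoint_inner_right]
  left_right a d x := by simp
  norm_sq x := by simp [inner_self_eq_norm_sq_to_K]

section

variable {A X : Type*} [NonUnitalCStarAlgebra A] [AddCommGroup X] [Module ℂ X] (P : PreCorr A ℂ X)

/-- For `D = ℂ` the completion is a Hilbert space. -/
instance : InnerProductSpace ℂ P.Hilb where
  inner x y := P.completion.inner x y
  norm_sq_eq_re_inner x := by
    have h := P.completion.inner_self_nonneg x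
    rw [P.completion.norm_sq]
    exact congrArg Complex.re (Complex.norm_of_nonneg' h)
  conj_inner_symm x y := P.completion.star_inner y x
  add_left x y z := by simp
  smul_left x y c := by simp

namespace PreCorr

theorem inner_hilb (x y : P.Hilb) : Inner.inner ℂ x y = P.completion.inner x y := rfl

theorem inner_emb (x y : X) : Inner.inner ℂ (P.emb x) (P.emb y) = P.inner x y :=
  P.completion_inner_emb x y

/-- The representation of `A` on the Hilbert space `P.Hilb`. -/
def rep : HilbertRep A P.Hilb where
  toFun := P.leftHilb
  map_smul' := map_smul P.leftHilb
  map_zero' := map_zero P.leftHilb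
  map_add' := map_add P.leftHilb
  map_mul' a b := ContinuousLinearMap.ext fun x => P.completion.left_mul a b x
  map_star' a := by
    rw [ContinuousLinearMap.star_eq_adjoint, ContinuousLinearMap.eq_adjoint_iff]
    intro x y
    have := P.completion.inner_left (star a) x y
    rwa [star_star] at this

theorem rep_emb (a : A) (x : X) : P.rep a (P.emb x) = P.emb (P.left a x) := P.leftHilb_emb a x

theorem bound_of_inner {Y : Type*} [NormedAddCommGroup Y] [InnerProductSpace ℂ Y]
    {f : X →ₗ[ℂ] Y} (hf : ∀ x, Inner.inner ℂ (f x) (f x) = P.inner x x) :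
    ∃ C, ∀ x, ‖f x‖ ≤ C * ‖P.emb x‖ :=
  ⟨1, fun x => by
    rw [one_mul, ← sq_le_sq₀ (norm_nonneg _) (norm_nonneg _), norm_emb_sq, ← hf]
    simp [inner_self_eq_norm_sq_to_K]⟩

end PreCorr

end

/-- The space of bounded operators that intertwine two representations of `B`. -/
def intertwiners {B H H' : Type*} [NonUnitalCStarAlgebra B] [NormedAddCommGroup H]
    [InnerProductSpace ℂ H] [CompleteSpace H] [NormedAddCommGroup H'] [InnerProductSpace ℂ H']
    [CompleteSpace H'] (σ : HilbertRep B H) (τ : HilbertRep B H') : Submodule ℂ (H →L[ℂ] H') where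
  carrier := {X | ∀ b, X ∘L σ b = τ b ∘L X}
  add_mem' {X Y} hX hY b := by
    rw [ContinuousLinearMap.add_comp, hX b, hY b, ContinuousLinearMap.comp_add]
  zero_mem' b := by simp
  smul_mem' c X hX b := by
    rw [ContinuousLinearMap.smul_comp, hX b, ContinuousLinearMap.comp_smul]

/-- The type of bounded operators that intertwine two representations of `B`. -/
abbrev Intertwiner {B H H' : Type*} [NonUnitalCStarAlgebra B] [NormedAddCommGroup H]
    [InnerProductSpace ℂ H] [CompleteSpace H] [NormedAddCommGroup H'] [InnerProductSpace ℂ H']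
    [CompleteSpace H'] (σ : HilbertRep B H) (τ : HilbertRep B H') : Type _ :=
  intertwiners σ τ

namespace Intertwiner

variable {B H₁ H₂ H₃ : Type*} [NonUnitalCStarAlgebra B]
  [NormedAddCommGroup H₁] [InnerProductSpace ℂ H₁] [CompleteSpace H₁]
  [NormedAddCommGroup H₂] [InnerProductSpace ℂ H₂] [CompleteSpace H₂]
  [NormedAddCommGroup H₃] [InnerProductSpace ℂ H₃] [CompleteSpace H₃]
  {σ₁ : HilbertRep B H₁} {σ₂ : HilbertRep B H₂} {σ₃ : HilbertRep B H₃}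

theorem apply_rep (X : Intertwiner σ₁ σ₂) (b : B) (h : H₁) :
    X.1 (σ₁ b h) = σ₂ b (X.1 h) := DFunLike.congr_fun (X.2 b) h

/-- The identity operator. -/
def one (σ : HilbertRep B H₁) : Intertwiner σ σ :=
  ⟨ContinuousLinearMap.id ℂ H₁, fun _ => rfl⟩

/-- The product `Y X`. -/
def comp (Y : Intertwiner σ₂ σ₃) (X : Intertwiner σ₁ σ₂) : Intertwiner σ₁ σ₃ :=
  ⟨Y.1 ∘L X.1, fun b => by
    rw [ContinuousLinearMap.comp_assoc, X.2 b, ← ContinuousLinearMap.comp_assoc, Y.2 b,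
      ContinuousLinearMap.comp_assoc]⟩

/-- The adjoint `X*`. -/
def adj (X : Intertwiner σ₁ σ₂) : Intertwiner σ₂ σ₁ :=
  ⟨ContinuousLinearMap.adjoint X.1, fun b => by
    have h := congrArg ContinuousLinearMap.adjoint (X.2 (star b))
    rw [ContinuousLinearMap.adjoint_comp, ContinuousLinearMap.adjoint_comp,
      ← ContinuousLinearMap.star_eq_adjoint (σ₁ _), ← ContinuousLinearMap.star_eq_adjoint (σ₂ _),
      ← map_star σ₁, ← map_star σ₂, star_star] at h
    exact h.symm⟩

/-- The orthogonal projection onto a closed invariant subspace. -/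
def proj (σ : HilbertRep B H₁) (K : ClosedSubmodule ℂ H₁) (hK : ∀ b, ∀ h ∈ K, σ b h ∈ K) :
    Intertwiner σ σ :=
  ⟨K.toSubmodule.starProjection, fun b => by
    have hK' : ∀ b, ∀ h ∈ K.toSubmoduleᗮ, σ b h ∈ K.toSubmoduleᗮ := fun b h hh =>
      (Submodule.mem_orthogonal' _ _).mpr fun u hu => by
        have := (Submodule.mem_orthogonal' _ _).mp hh _ (hK (star b) u hu)
        rwa [map_star, ContinuousLinearMap.star_eq_adjoint,
          ContinuousLinearMap.adjoint_inner_right] at this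
    ext h
    obtain ⟨y, hy, z, hz, rfl⟩ := K.toSubmodule.exists_add_mem_mem_orthogonal h
    simp only [ContinuousLinearMap.comp_apply, map_add]
    rw [Submodule.starProjection_eq_self_iff.mpr hy,
      Submodule.starProjection_eq_self_iff.mpr (hK b y hy),
      (Submodule.starProjection_apply_eq_zero_iff _).mpr hz,
      (Submodule.starProjection_apply_eq_zero_iff _).mpr (hK' b z hz), map_zero]⟩

end Intertwiner

theorem norm_sum_inner_self {H ι : Type*} [NormedAddCommGroup H] [InnerProductSpace ℂ H] [Fintype ι]
    (v : ι → H) : ‖∑ k, inner ℂ (v k) (v k)‖ = ∑ k, ‖v k‖ ^ 2 := by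
  simp only [inner_self_eq_norm_sq_to_K]
  norm_cast
  exact abs_of_nonneg (by positivity)

/-! ### Interior tensor products -/

namespace Corr

section

variable {A B D E F : Type*} [NonUnitalCStarAlgebra A]
  [NonUnitalCStarAlgebra B] [PartialOrder B] [StarOrderedRing B]
  [NonUnitalCStarAlgebra D] [PartialOrder D] [StarOrderedRing D]
  [NormedAddCommGroup E] [NormedSpace ℂ E] [NormedAddCommGroup F] [NormedSpace ℂ F]

/-- The space underlying the interior tensor product `C ⊗_B C'`. -/
abbrev Tensor (C : Corr A B E) (C' : Corr B D F) : Type _ :=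
  (C.toPreCorr.tensor C'.toPreCorr).Hilb

/-- The interior tensor product `C ⊗_B C'` of correspondences. -/
def tensor (C : Corr A B E) (C' : Corr B D F) : Corr A D (C.Tensor C') :=
  (C.toPreCorr.tensor C'.toPreCorr).completion

/-- The elementary tensors `ξ ⊗ η`. -/
def tmul (C : Corr A B E) (C' : Corr B D F) : E →ₗ[ℂ] F →ₗ[ℂ] C.Tensor C' :=
  (TensorProduct.mk ℂ E F).compr₂ (C.toPreCorr.tensor C'.toPreCorr).emb

theorem inner_tmul (C : Corr A B E) (C' : Corr B D F) (ξ ξ' : E) (η η' : F) :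
    (C.tensor C').inner (C.tmul C' ξ η) (C.tmul C' ξ' η')
      = C'.inner η (C'.left (C.inner ξ ξ') η') :=
  (PreCorr.completion_inner_emb _ _ _).trans (PreCorr.tensorInner_tmul _ _ _ _ _ _)

end

section

variable {A B E H H' : Type*} [NonUnitalCStarAlgebra A]
  [NonUnitalCStarAlgebra B] [PartialOrder B] [StarOrderedRing B]
  [NormedAddCommGroup E] [NormedSpace ℂ E]
  [NormedAddCommGroup H] [InnerProductSpace ℂ H] [CompleteSpace H]
  [NormedAddCommGroup H'] [InnerProductSpace ℂ H'] [CompleteSpace H']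

/-- The algebraic interior tensor product of a correspondence and a represented Hilbert space. -/
abbrev pre (C : Corr A B E) (σ : HilbertRep B H) : PreCorr A ℂ (E ⊗[ℂ] H) :=
  C.toPreCorr.tensor (repCorr σ).toPreCorr

/-- The Hilbert space `E ⊗_σ H`. -/
abbrev HTensor (C : Corr A B E) (σ : HilbertRep B H) : Type _ := C.Tensor (repCorr σ)

/-- The elementary tensor `ξ ⊗ h` in `E ⊗_σ H`. -/
abbrev htmul (C : Corr A B E) (σ : HilbertRep B H) : E →ₗ[ℂ] H →ₗ[ℂ] C.HTensor σ :=
  C.tmul (repCorr σ)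

/-- The induced representation `a ↦ φ(a) ⊗ I_H` on `E ⊗_σ H`, where `φ` is the left action. -/
def ind (C : Corr A B E) (σ : HilbertRep B H) : HilbertRep A (C.HTensor σ) := (C.pre σ).rep

theorem inner_htmul (C : Corr A B E) (σ : HilbertRep B H) (ξ ξ' : E) (h h' : H) :
    inner ℂ (C.htmul σ ξ h) (C.htmul σ ξ' h') = inner ℂ h (σ (C.inner ξ ξ') h') :=
  C.inner_tmul (repCorr σ) ξ ξ' h h'

theorem ind_htmul (C : Corr A B E) (σ : HilbertRep B H) (a : A) (ξ : E) (h : H) :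
    C.ind σ a (C.htmul σ ξ h) = C.htmul σ (C.left a ξ) h :=
  (C.pre σ).rep_emb a (ξ ⊗ₜ h)

theorem bound_amp (C : Corr A B E) {σ : HilbertRep B H} {τ : HilbertRep B H'}
    (X : Intertwiner σ τ) :
    ∃ M, ∀ u, ‖((C.pre τ).emb ∘ₗ LinearMap.lTensor E (X.1 : H →ₗ[ℂ] H')) u‖
      ≤ M * ‖(C.pre σ).emb u‖ := by
  have key : ∀ u, ‖(C.pre τ).inner (LinearMap.lTensor E (X.1 : H →ₗ[ℂ] H') u)
      (LinearMap.lTensor E (X.1 : H →ₗ[ℂ] H') u)‖ ≤ ‖X.1‖ ^ 2 * ‖(C.pre σ).inner u u‖ := by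
    intro u
    obtain ⟨ι, _, ξ, η, rfl⟩ := PreCorr.exists_tensor_sum u
    obtain ⟨c, hc⟩ := C.toPreCorr.exists_gram_factor ξ
    have e0 : LinearMap.lTensor E (X.1 : H →ₗ[ℂ] H') (∑ i, ξ i ⊗ₜ[ℂ] η i)
        = ∑ i, ξ i ⊗ₜ[ℂ] X.1 (η i) := by simp
    have e1 : ∀ k, ∑ i, (repCorr τ).left (c k i) (X.1 (η i))
        = X.1 (∑ i, (repCorr σ).left (c k i) (η i)) := fun k => by
      rw [map_sum]
      exact Finset.sum_congr rfl fun i _ => (X.apply_rep (c k i) (η i)).symm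
    have e3 : ‖(C.pre τ).inner (∑ i, ξ i ⊗ₜ[ℂ] X.1 (η i)) (∑ i, ξ i ⊗ₜ[ℂ] X.1 (η i))‖
        = ∑ k, ‖X.1 (∑ i, (repCorr σ).left (c k i) (η i))‖ ^ 2 := by
      refine (congrArg norm (PreCorr.tensorInner_self _ _ hc _)).trans
        ((norm_sum_inner_self _).trans ?_)
      exact Finset.sum_congr rfl fun k _ => by rw [e1]
    have e4 : ‖(C.pre σ).inner (∑ i, ξ i ⊗ₜ[ℂ] η i) (∑ i, ξ i ⊗ₜ[ℂ] η i)‖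
        = ∑ k, ‖∑ i, (repCorr σ).left (c k i) (η i)‖ ^ 2 :=
      (congrArg norm (PreCorr.tensorInner_self _ _ hc _)).trans (norm_sum_inner_self _)
    rw [e0, e3, e4, Finset.mul_sum]
    gcongr with k
    rw [← mul_pow]
    gcongr
    exact X.1.le_opNorm _
  exact ⟨‖X.1‖, fun u => (C.pre τ).norm_emb_le (LinearMap.lTensor E (X.1 : H →ₗ[ℂ] H') u)
    ((C.pre σ).emb u) _ (norm_nonneg _) (by rw [PreCorr.norm_emb_sq]; exact key u)⟩

/-- The operator `I_E ⊗ X` from `E ⊗_σ H` to `E ⊗_τ H'`, for an intertwiner `X`. -/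
def amp (C : Corr A B E) {σ : HilbertRep B H} {τ : HilbertRep B H'} (X : Intertwiner σ τ) :
    Intertwiner (C.ind σ) (C.ind τ) :=
  ⟨(C.pre σ).lift ((C.pre τ).emb ∘ₗ LinearMap.lTensor E (X.1 : H →ₗ[ℂ] H')), fun a => by
    refine (C.pre σ).ext_clm fun u => ?_
    simp only [ContinuousLinearMap.comp_apply, ind, PreCorr.rep_emb,
      PreCorr.lift_emb _ (C.bound_amp X), LinearMap.comp_apply]
    congr 1
    exact DFunLike.congr_fun ((LinearMap.lTensor_comp_rTensor _ _ _).trans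
      (LinearMap.rTensor_comp_lTensor _ _ _).symm) u⟩

theorem amp_htmul (C : Corr A B E) {σ : HilbertRep B H} {τ : HilbertRep B H'}
    (X : Intertwiner σ τ) (ξ : E) (h : H) :
    (C.amp X).1 (C.htmul σ ξ h) = C.htmul τ ξ (X.1 h) :=
  (C.pre σ).lift_emb (C.bound_amp X) (ξ ⊗ₜ h)

end

end Corr

/-- A unitary isomorphism of correspondences: a linear bijection that preserves the inner products
and intertwines the left and right actions. -/
structure CorrIso {A D E F : Type*} [NonUnitalCStarAlgebra A]
    [NonUnitalCStarAlgebra D] [PartialOrder D] [StarOrderedRing D]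
    [NormedAddCommGroup E] [NormedSpace ℂ E] [NormedAddCommGroup F] [NormedSpace ℂ F]
    (C : Corr A D E) (C' : Corr A D F) where
  toLinearEquiv : E ≃ₗ[ℂ] F
  inner_map : ∀ x y, C'.inner (toLinearEquiv x) (toLinearEquiv y) = C.inner x y
  map_left : ∀ a x, toLinearEquiv (C.left a x) = C'.left a (toLinearEquiv x)
  map_right : ∀ d x, toLinearEquiv (C.right d x) = C'.right d (toLinearEquiv x)

namespace CorrIso

variable {A D E F : Type*} [NonUnitalCStarAlgebra A]
    [NonUnitalCStarAlgebra D] [PartialOrder D] [StarOrderedRing D]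
    [NormedAddCommGroup E] [NormedSpace ℂ E] [NormedAddCommGroup F] [NormedSpace ℂ F]
    {C : Corr A D E} {C' : Corr A D F}
    {H : Type*} [NormedAddCommGroup H] [InnerProductSpace ℂ H] [CompleteSpace H]

/-- The identity isomorphism. -/
def refl (C : Corr A D E) : CorrIso C C where
  toLinearEquiv := LinearEquiv.refl ℂ E
  inner_map _ _ := rfl
  map_left _ _ := rfl
  map_right _ _ := rfl

/-- The inverse isomorphism. -/
def symm (U : CorrIso C C') : CorrIso C' C where
  toLinearEquiv := U.toLinearEquiv.symm
  inner_map x y := by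
    rw [← U.inner_map, LinearEquiv.apply_symm_apply, LinearEquiv.apply_symm_apply]
  map_left a x := by
    rw [LinearEquiv.symm_apply_eq, U.map_left, LinearEquiv.apply_symm_apply]
  map_right a x := by
    rw [LinearEquiv.symm_apply_eq, U.map_right, LinearEquiv.apply_symm_apply]

theorem inner_amp_aux (U : CorrIso C C') (σ : HilbertRep D H) (u v : E ⊗[ℂ] H) :
    (C'.pre σ).inner (LinearMap.rTensor H (U.toLinearEquiv : E →ₗ[ℂ] F) u)
      (LinearMap.rTensor H (U.toLinearEquiv : E →ₗ[ℂ] F) v) = (C.pre σ).inner u v := by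
  induction u with
  | zero => simp
  | add u u' hu hu' => simp only [map_add, LinearMap.add_apply, hu, hu']
  | tmul ξ h =>
    induction v with
    | zero => simp
    | add u u' hu hu' => simp only [map_add, hu, hu']
    | tmul ξ' h' =>
      change C'.toPreCorr.tensorInner (repCorr σ).toPreCorr (U.toLinearEquiv ξ ⊗ₜ h)
        (U.toLinearEquiv ξ' ⊗ₜ h') = C.toPreCorr.tensorInner (repCorr σ).toPreCorr _ _
      rw [PreCorr.tensorInner_tmul, PreCorr.tensorInner_tmul, U.inner_map]

theorem bound_amp (U : CorrIso C C') (σ : HilbertRep D H) :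
    ∃ M, ∀ u, ‖((C'.pre σ).emb ∘ₗ LinearMap.rTensor H (U.toLinearEquiv : E →ₗ[ℂ] F)) u‖
      ≤ M * ‖(C.pre σ).emb u‖ :=
  (C.pre σ).bound_of_inner fun u => by
    rw [LinearMap.comp_apply, PreCorr.inner_emb, U.inner_amp_aux]

/-- The unitary operator `U ⊗ I_H` from `E ⊗_σ H` to `F ⊗_σ H`. -/
def amp (U : CorrIso C C') (σ : HilbertRep D H) : Intertwiner (C.ind σ) (C'.ind σ) :=
  ⟨(C.pre σ).lift ((C'.pre σ).emb ∘ₗ LinearMap.rTensor H (U.toLinearEquiv : E →ₗ[ℂ] F)),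
  fun a => by
    refine (C.pre σ).ext_clm fun u => ?_
    simp only [ContinuousLinearMap.comp_apply, Corr.ind, PreCorr.rep_emb,
      PreCorr.lift_emb _ (U.bound_amp σ), LinearMap.comp_apply]
    congr 1
    induction u with
    | zero => simp
    | add u u' hu hu' => simp only [map_add, hu, hu']
    | tmul ξ h =>
      change U.toLinearEquiv (C.left a ξ) ⊗ₜ[ℂ] h = C'.left a (U.toLinearEquiv ξ) ⊗ₜ[ℂ] h
      rw [U.map_left]⟩

theorem amp_htmul (U : CorrIso C C') (σ : HilbertRep D H) (ξ : E) (h : H) :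
    (U.amp σ).1 (C.htmul σ ξ h) = C'.htmul σ (U.toLinearEquiv ξ) h :=
  (C.pre σ).lift_emb (U.bound_amp σ) (ξ ⊗ₜ h)

end CorrIso

namespace Corr

variable {A B D E F H : Type*} [NonUnitalCStarAlgebra A]
  [NonUnitalCStarAlgebra B] [PartialOrder B] [StarOrderedRing B]
  [NonUnitalCStarAlgebra D] [PartialOrder D] [StarOrderedRing D]
  [NormedAddCommGroup E] [NormedSpace ℂ E] [NormedAddCommGroup F] [NormedSpace ℂ F]
  [NormedAddCommGroup H] [InnerProductSpace ℂ H] [CompleteSpace H]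
  (C : Corr A B E) (C' : Corr B D F) (σ : HilbertRep D H)

/-- For fixed `h`, the map `ξ ⊗ η ↦ ξ ⊗ (η ⊗ h)` on the algebraic tensor product. -/
def assocAux (h : H) : E ⊗[ℂ] F →ₗ[ℂ] C.HTensor (C'.ind σ) :=
  TensorProduct.lift ((C.htmul (C'.ind σ)).compl₂ ((C'.htmul σ).flip h))

theorem assocAux_tmul (h : H) (ξ : E) (η : F) :
    C.assocAux C' σ h (ξ ⊗ₜ η) = C.htmul (C'.ind σ) ξ (C'.htmul σ η h) := by
  simp [assocAux]

theorem inner_assocAux (h k : H) (u v : E ⊗[ℂ] F) :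
    inner ℂ (C.assocAux C' σ h u) (C.assocAux C' σ k v)
      = inner ℂ h (σ ((C.toPreCorr.tensor C'.toPreCorr).inner u v) k) := by
  induction u with
  | zero => simp
  | add u u' hu hu' => simp only [map_add, inner_add_left, hu, hu', LinearMap.add_apply,
      _root_.add_apply, inner_add_right]
  | tmul ξ η =>
    induction v with
    | zero => simp
    | add u u' hu hu' => simp only [map_add, hu, hu', _root_.add_apply, inner_add_right]
    | tmul ξ' η' =>
      rw [assocAux_tmul, assocAux_tmul, inner_htmul, ind_htmul, inner_htmul]
      exact congrArg (fun d => inner ℂ h (σ d k))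
        (PreCorr.tensorInner_tmul C.toPreCorr C'.toPreCorr ξ ξ' η η').symm

theorem bound_assocAux (h : H) : ∃ M, ∀ u, ‖C.assocAux C' σ h u‖
    ≤ M * ‖(C.toPreCorr.tensor C'.toPreCorr).emb u‖ := by
  refine ⟨‖h‖, fun u => ?_⟩
  refine abs_le_of_sq_le_sq' ?_ (by positivity) |>.2
  rw [mul_pow, PreCorr.norm_emb_sq]
  have e := C.inner_assocAux C' σ h h u u
  rw [inner_self_eq_norm_sq_to_K] at e
  have e' := congrArg norm e
  rw [norm_pow, RCLike.norm_ofReal, abs_norm] at e'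
  rw [e']
  calc _ ≤ ‖h‖ * (‖(C.toPreCorr.tensor C'.toPreCorr).inner u u‖ * ‖h‖) := by
        refine (_root_.norm_inner_le_norm _ _).trans ?_
        gcongr
        refine (ContinuousLinearMap.le_opNorm _ _).trans ?_
        gcongr
        exact NonUnitalStarAlgHom.norm_apply_le σ _
    _ = _ := by ring

/-- The bilinear map `(z, h) ↦ z ⊗ h` from `(E ⊗ F) × H` to `E ⊗ (F ⊗ H)`. -/
def assocBilin : C.Tensor C' →ₗ[ℂ] H →ₗ[ℂ] C.HTensor (C'.ind σ) :=
  LinearMap.flip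
    { toFun := fun h => ((C.toPreCorr.tensor C'.toPreCorr).lift (C.assocAux C' σ h) :
        C.Tensor C' →ₗ[ℂ] C.HTensor (C'.ind σ))
      map_add' := fun h k => by
        rw [← ContinuousLinearMap.toLinearMap_add]
        congr 1
        refine PreCorr.ext_clm _ fun u => ?_
        rw [_root_.add_apply]
        simp only [PreCorr.lift_emb _ (C.bound_assocAux C' σ _)]
        rw [← LinearMap.add_apply]
        congr 1
        exact TensorProduct.ext' fun ξ η => by simp [assocAux_tmul]
      map_smul' := fun c h => by
        rw [RingHom.id_apply, ← ContinuousLinearMap.toLinearMap_smul]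
        congr 1
        refine PreCorr.ext_clm _ fun u => ?_
        rw [_root_.smul_apply]
        simp only [PreCorr.lift_emb _ (C.bound_assocAux C' σ _)]
        rw [← LinearMap.smul_apply]
        congr 1
        exact TensorProduct.ext' fun ξ η => by simp [assocAux_tmul] }

theorem assocBilin_emb (u : E ⊗[ℂ] F) (h : H) :
    C.assocBilin C' σ ((C.toPreCorr.tensor C'.toPreCorr).emb u) h = C.assocAux C' σ h u :=
  PreCorr.lift_emb _ (C.bound_assocAux C' σ h) u

theorem continuous_assocBilin (h : H) : Continuous fun z => C.assocBilin C' σ z h :=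
  ((C.toPreCorr.tensor C'.toPreCorr).lift (C.assocAux C' σ h)).continuous

theorem inner_assocBilin (z w : C.Tensor C') (h k : H) :
    inner ℂ (C.assocBilin C' σ z h) (C.assocBilin C' σ w k)
      = inner ℂ h (σ ((C.tensor C').inner z w) k) := by
  revert z w
  refine PreCorr.induction_emb₂ _ (isClosed_eq ?_ ?_) fun u v => ?_
  · exact ((C.continuous_assocBilin C' σ h).comp continuous_fst).inner
      ((C.continuous_assocBilin C' σ k).comp continuous_snd)
  · have hσ : Continuous σ := AddMonoidHomClass.continuous_of_bound σ 1 fun d => by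
      simpa using NonUnitalStarAlgHom.norm_apply_le σ d
    have hi : Continuous fun p : C.Tensor C' × C.Tensor C' => (C.tensor C').inner p.1 p.2 := by
      change Continuous fun p : C.Tensor C' × C.Tensor C' =>
        (C.toPreCorr.tensor C'.toPreCorr).innerHilb p.1 p.2
      fun_prop
    exact continuous_const.inner ((hσ.comp hi).clm_apply continuous_const)
  · rw [assocBilin_emb, assocBilin_emb, inner_assocAux]
    exact congrArg (fun d => inner ℂ h (σ d k)) (PreCorr.completion_inner_emb _ u v).symm

theorem inner_lift_assocBilin (s t : C.Tensor C' ⊗[ℂ] H) :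
    inner ℂ (TensorProduct.lift (C.assocBilin C' σ) s) (TensorProduct.lift (C.assocBilin C' σ) t)
      = ((C.tensor C').pre σ).inner s t := by
  induction s with
  | zero => simp
  | add u u' hu hu' => simp only [map_add, inner_add_left, hu, hu', LinearMap.add_apply]
  | tmul z h =>
    induction t with
    | zero => simp
    | add u u' hu hu' => simp only [map_add, hu, hu', inner_add_right]
    | tmul w k =>
      rw [TensorProduct.lift.tmul, TensorProduct.lift.tmul, inner_assocBilin]
      exact (PreCorr.tensorInner_tmul _ (repCorr σ).toPreCorr z w h k).symm

theorem bound_assoc : ∃ M, ∀ s, ‖TensorProduct.lift (C.assocBilin C' σ) s‖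
    ≤ M * ‖((C.tensor C').pre σ).emb s‖ :=
  ((C.tensor C').pre σ).bound_of_inner fun s => C.inner_lift_assocBilin C' σ s s

theorem assocBilin_left (a : A) (z : C.Tensor C') (h : H) :
    C.assocBilin C' σ ((C.tensor C').left a z) h
      = C.ind (C'.ind σ) a (C.assocBilin C' σ z h) := by
  revert z
  refine PreCorr.induction_emb _ (isClosed_eq ?_ ?_) fun u => ?_
  · exact (C.continuous_assocBilin C' σ h).comp
      ((C.toPreCorr.tensor C'.toPreCorr).leftHilb a).continuous
  · exact (C.ind (C'.ind σ) a).continuous.comp (C.continuous_assocBilin C' σ h)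
  · rw [tensor, PreCorr.completion_left_emb, assocBilin_emb, assocBilin_emb]
    induction u with
    | zero => simp
    | add u u' hu hu' => simp only [map_add, hu, hu']
    | tmul ξ η =>
      rw [assocAux_tmul, ind_htmul]
      exact C.assocAux_tmul C' σ h (C.left a ξ) η

/-- The canonical unitary `(ξ ⊗ η) ⊗ h ↦ ξ ⊗ (η ⊗ h)` from `(E ⊗ F) ⊗ H` to `E ⊗ (F ⊗ H)`. -/
def assoc : Intertwiner ((C.tensor C').ind σ) (C.ind (C'.ind σ)) :=
  ⟨((C.tensor C').pre σ).lift (TensorProduct.lift (C.assocBilin C' σ)), fun a => by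
    refine PreCorr.ext_clm _ fun s => ?_
    simp only [ContinuousLinearMap.comp_apply]
    rw [PreCorr.lift_emb _ (C.bound_assoc C' σ)]
    change ((C.tensor C').pre σ).lift _ (((C.tensor C').pre σ).rep a _) = _
    rw [PreCorr.rep_emb, PreCorr.lift_emb _ (C.bound_assoc C' σ)]
    induction s with
    | zero => simp
    | add u u' hu hu' => simp only [map_add, hu, hu']
    | tmul z h => exact C.assocBilin_left C' σ a z h⟩

theorem assoc_htmul (ξ : E) (η : F) (h : H) :
    (C.assoc C' σ).1 ((C.tensor C').htmul σ (C.tmul C' ξ η) h)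
      = C.htmul (C'.ind σ) ξ (C'.htmul σ η h) :=
  (PreCorr.lift_emb _ (C.bound_assoc C' σ) _).trans
    ((C.assocBilin_emb C' σ (ξ ⊗ₜ η) h).trans (C.assocAux_tmul C' σ h ξ η))

end Corr

/-! ### Product systems and their covariant representations -/

/-- A product system over `ℕ₀ᵏ`, given by `C⋆`-correspondences `E 1, …, E k` over `B` and unitary
isomorphisms `t i j : E i ⊗ E j → E j ⊗ E i` with `t i i = id` and `t j i = (t i j)⁻¹`. -/
structure ProductSystem (B : Type*) [NonUnitalCStarAlgebra B] [PartialOrder B] [StarOrderedRing B]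
    {k : ℕ} (E : Fin k → Type*) [∀ i, NormedAddCommGroup (E i)] [∀ i, NormedSpace ℂ (E i)]
    [∀ i, CompleteSpace (E i)] where
  corr : ∀ i, Corr B B (E i)
  t : ∀ i j, CorrIso ((corr i).tensor (corr j)) ((corr j).tensor (corr i))
  t_self : ∀ i, t i i = CorrIso.refl _
  t_symm : ∀ i j, t j i = (t i j).symm

namespace ProductSystem

variable {B : Type*} [NonUnitalCStarAlgebra B] [PartialOrder B] [StarOrderedRing B]
  {k : ℕ} {E : Fin k → Type*} [∀ i, NormedAddCommGroup (E i)] [∀ i, NormedSpace ℂ (E i)]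
  [∀ i, CompleteSpace (E i)] (𝔼 : ProductSystem B E)
  {H : Type*} [NormedAddCommGroup H] [InnerProductSpace ℂ H] [CompleteSpace H]

/-- The Hilbert space `E i ⊗ H`. -/
abbrev HTensor (i : Fin k) (σ : HilbertRep B H) : Type _ := (𝔼.corr i).HTensor σ

/-- The operator `t i j ⊗ I_H` from `E i ⊗ (E j ⊗ H)` to `E j ⊗ (E i ⊗ H)`, where
`(E i ⊗ E j) ⊗ H` is identified with `E i ⊗ (E j ⊗ H)` by the canonical unitary. -/
def swap (i j : Fin k) (σ : HilbertRep B H) :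
    Intertwiner ((𝔼.corr i).ind ((𝔼.corr j).ind σ)) ((𝔼.corr j).ind ((𝔼.corr i).ind σ)) :=
  Intertwiner.comp ((𝔼.corr j).assoc (𝔼.corr i) σ)
    (Intertwiner.comp ((𝔼.t i j).amp σ) (Intertwiner.adj ((𝔼.corr i).assoc (𝔼.corr j) σ)))

end ProductSystem

/-- A completely bounded covariant representation `(σ, V)` of a correspondence `C` over `B`, with
given `σ`: the linear map `V` satisfies `V(a ξ) = σ(a) V(ξ)` and `V(ξ b) = V(ξ) σ(b)`, and
`ξ ⊗ h ↦ V(ξ) h` extends to a bounded operator on `E ⊗_σ H`. -/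
structure CovRepOn {B E H : Type*} [NonUnitalCStarAlgebra B] [PartialOrder B] [StarOrderedRing B]
    [NormedAddCommGroup E] [NormedSpace ℂ E]
    [NormedAddCommGroup H] [InnerProductSpace ℂ H] [CompleteSpace H]
    (C : Corr B B E) (σ : HilbertRep B H) where
  toLinearMap : E →ₗ[ℂ] H →L[ℂ] H
  map_left : ∀ a ξ, toLinearMap (C.left a ξ) = σ a ∘L toLinearMap ξ
  map_right : ∀ b ξ, toLinearMap (C.right b ξ) = toLinearMap ξ ∘L σ b
  bounded : ∃ M : ℝ, ∀ u : E ⊗[ℂ] H,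
    ‖TensorProduct.lift (ContinuousLinearMap.coeLM ℂ ∘ₗ toLinearMap) u‖ ≤ M * ‖(C.pre σ).emb u‖

namespace CovRepOn

variable {B E H : Type*} [NonUnitalCStarAlgebra B] [PartialOrder B] [StarOrderedRing B]
    [NormedAddCommGroup E] [NormedSpace ℂ E]
    [NormedAddCommGroup H] [InnerProductSpace ℂ H] [CompleteSpace H]
    {C : Corr B B E} {σ : HilbertRep B H} (V : CovRepOn C σ)

/-- The operator `Ṽ : E ⊗_σ H → H`, `ξ ⊗ h ↦ V(ξ) h`. -/
def tilde : Intertwiner (C.ind σ) σ :=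
  ⟨(C.pre σ).lift (TensorProduct.lift (ContinuousLinearMap.coeLM ℂ ∘ₗ V.toLinearMap)),
  fun a => by
    refine (C.pre σ).ext_clm fun u => ?_
    simp only [ContinuousLinearMap.comp_apply, Corr.ind, PreCorr.rep_emb,
      PreCorr.lift_emb _ V.bounded]
    induction u with
    | zero => simp
    | add u u' hu hu' => simp only [map_add, hu, hu']
    | tmul ξ h => exact DFunLike.congr_fun (V.map_left a ξ) h⟩

theorem tilde_htmul (ξ : E) (h : H) : V.tilde.1 (C.htmul σ ξ h) = V.toLinearMap ξ h :=
  (C.pre σ).lift_emb V.bounded (ξ ⊗ₜ h)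

/-- The completely positive map `X ↦ Ṽ (I_E ⊗ X) Ṽ*` on the commutant of `σ(B)`. -/
def cpMap (X : Intertwiner σ σ) : Intertwiner σ σ :=
  Intertwiner.comp V.tilde (Intertwiner.comp (C.amp X) (Intertwiner.adj V.tilde))

end CovRepOn

section

variable {B : Type*} [NonUnitalCStarAlgebra B] [PartialOrder B] [StarOrderedRing B]
  {k : ℕ} {E : Fin k → Type*} [∀ i, NormedAddCommGroup (E i)] [∀ i, NormedSpace ℂ (E i)]
  [∀ i, CompleteSpace (E i)]

/-- A completely bounded covariant representation `(σ, V⁽¹⁾, …, V⁽ᵏ⁾)` of a product system on the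
Hilbert space `H`. The commutation relation is
`Ṽ⁽ⁱ⁾ (I_{E i} ⊗ Ṽ⁽ʲ⁾) = Ṽ⁽ʲ⁾ (I_{E j} ⊗ Ṽ⁽ⁱ⁾) (t i j ⊗ I_H)`. -/
structure CovRep (𝔼 : ProductSystem B E) (H : Type*)
    [NormedAddCommGroup H] [InnerProductSpace ℂ H] [CompleteSpace H] where
  σ : HilbertRep B H
  V : ∀ i, CovRepOn (𝔼.corr i) σ
  commute : ∀ i j,
    Intertwiner.comp (V i).tilde ((𝔼.corr i).amp (V j).tilde)
      = Intertwiner.comp (V j).tilde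
          (Intertwiner.comp ((𝔼.corr j).amp (V i).tilde) (𝔼.swap i j σ))

namespace CovRep

variable {𝔼 : ProductSystem B E} {H : Type w}
  [NormedAddCommGroup H] [InnerProductSpace ℂ H] [CompleteSpace H] (V : CovRep 𝔼 H)

/-- The operator `Ṽ⁽ⁱ⁾ : E i ⊗_σ H → H`. -/
abbrev tilde (i : Fin k) : Intertwiner ((𝔼.corr i).ind V.σ) V.σ := (V.V i).tilde

/-- Doubly commuting isometric representations: every `Ṽ⁽ⁱ⁾` is an isometry and
`Ṽ⁽ʲ⁾* Ṽ⁽ⁱ⁾ = (I_{E j} ⊗ Ṽ⁽ⁱ⁾) (t i j ⊗ I_H) (I_{E i} ⊗ Ṽ⁽ʲ⁾*)` for `i ≠ j`. -/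
structure IsDoublyCommutingIsometric : Prop where
  isometry : ∀ i, Isometry (V.tilde i).1
  doubly_commute : ∀ i j, i ≠ j →
    Intertwiner.comp (Intertwiner.adj (V.tilde j)) (V.tilde i)
      = Intertwiner.comp ((𝔼.corr j).amp (V.tilde i))
          (Intertwiner.comp (𝔼.swap i j V.σ) ((𝔼.corr i).amp (Intertwiner.adj (V.tilde j))))

/-- A covariant representation is pure if, for every `i`, the operators `Ṽ⁽ⁱ⁾ₙ Ṽ⁽ⁱ⁾ₙ*` converge to
`0` strongly, where `Ṽ⁽ⁱ⁾ₙ : (E i)^{⊗ n} ⊗ H → H` is the `n`-fold iterate determined by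
`Ṽ⁽ⁱ⁾₀ = I_H` and `Ṽ⁽ⁱ⁾ₙ₊₁ = Ṽ⁽ⁱ⁾ (I_{E i} ⊗ Ṽ⁽ⁱ⁾ₙ)`. With `Φ(X) = Ṽ⁽ⁱ⁾ (I_{E i} ⊗ X) Ṽ⁽ⁱ⁾*` this
recursion gives `Ṽ⁽ⁱ⁾ₙ Ṽ⁽ⁱ⁾ₙ* = Φⁿ(I_H)`. -/
def IsPure : Prop :=
  ∀ i h, Filter.Tendsto (fun n : ℕ => ((V.V i).cpMap^[n] (Intertwiner.one V.σ)).1 h)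
    Filter.atTop (nhds 0)

/-- The closed subspace `E i ⊗ K` of `E i ⊗_σ H`, for a subspace `K` of `H`. -/
def tensorSubspace (i : Fin k) (K : Submodule ℂ H) : Submodule ℂ (𝔼.HTensor i V.σ) :=
  (Submodule.span ℂ {z | ∃ ξ : E i, ∃ h ∈ K, z = (𝔼.corr i).htmul V.σ ξ h}).topologicalClosure

/-- A closed subspace `K` is a quotient subspace if it is `σ`-invariant and
`Ṽ⁽ⁱ⁾* K ⊆ E i ⊗ K` for every `i`. -/
structure IsQuotientSubspace (K : ClosedSubmodule ℂ H) : Prop where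
  rep_mem : ∀ b, ∀ h ∈ K, V.σ b h ∈ K
  adj_mem : ∀ i, ∀ h ∈ K, (Intertwiner.adj (V.tilde i)).1 h ∈ V.tensorSubspace i K.toSubmodule

/-- A bounded operator `M` from the space of `W` to the space of `V` is multi-analytic if
`M W⁽ⁱ⁾(ξ) = V⁽ⁱ⁾(ξ) M` and `M π(a) = σ(a) M`. -/
structure IsMultiAnalytic {H' : Type*} [NormedAddCommGroup H'] [InnerProductSpace ℂ H']
    [CompleteSpace H'] (W : CovRep 𝔼 H') (V : CovRep 𝔼 H) (M : H' →L[ℂ] H) : Prop where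
  map_V : ∀ i (ξ : E i) h, M ((W.V i).toLinearMap ξ h) = (V.V i).toLinearMap ξ (M h)
  map_rep : ∀ a h, M (W.σ a h) = V.σ a (M h)

/-- A closed subspace `K` is a Beurling quotient subspace if `K = H ⊖ M H'` for an isometric
multi-analytic operator `M : H' → H`, where `H'` carries a pure doubly commuting isometric
representation. -/
def IsBeurlingQuotientSubspace (K : ClosedSubmodule ℂ H) : Prop :=
  ∃ (H' : Type w) (_ : NormedAddCommGroup H') (_ : InnerProductSpace ℂ H') (_ : CompleteSpace H')
    (W : CovRep 𝔼 H') (M : H' →L[ℂ] H),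
    W.IsDoublyCommutingIsometric ∧ W.IsPure ∧ IsMultiAnalytic W V M ∧ Isometry M ∧
      K.toSubmodule = (M.range)ᗮ

variable {V} {K : ClosedSubmodule ℂ H} (hK : V.IsQuotientSubspace K)

/-- The orthogonal projection `P_K`. -/
def IsQuotientSubspace.proj : Intertwiner V.σ V.σ := Intertwiner.proj V.σ K hK.rep_mem

/-- The compression `T̃⁽ⁱ⁾ = P_K Ṽ⁽ⁱ⁾ (I_{E i} ⊗ P_K)`, as an operator from `E i ⊗ H` to `H`. -/
def IsQuotientSubspace.compression (i : Fin k) : Intertwiner ((𝔼.corr i).ind V.σ) V.σ :=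
  Intertwiner.comp hK.proj (Intertwiner.comp (V.tilde i) ((𝔼.corr i).amp hK.proj))

/-- The operator `(I_{E i} ⊗ P_K) - T̃⁽ⁱ⁾* T̃⁽ⁱ⁾` on `E i ⊗ H`. -/
def IsQuotientSubspace.defect (i : Fin k) :
    Intertwiner ((𝔼.corr i).ind V.σ) ((𝔼.corr i).ind V.σ) :=
  (𝔼.corr i).amp hK.proj - Intertwiner.comp (Intertwiner.adj (hK.compression i)) (hK.compression i)

end CovRep

end

end

/-!
Let `J : H' → H` be an isometric multi-analytic operator from a covariant representation `W` to the
pure doubly commuting isometric representation `V`, and let `Q = I - J J*`. Then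
`Ṽ⁽ⁱ⁾ (I ⊗ J) = J W̃⁽ⁱ⁾`, so that `W̃⁽ⁱ⁾ = J* Ṽ⁽ⁱ⁾ (I ⊗ J)` and every `W̃⁽ⁱ⁾` is an isometry. Moreover
`W` is pure: for the completely positive maps `Φ_V` and `Φ_W`, the projection
`Φ_Vⁿ(J J*) = J Φ_Wⁿ(I) J*` is dominated by `Φ_Vⁿ(I)`
(`CovRep.IsMultiAnalytic.isPure`). The only question is whether `W` is doubly commuting.

Compress the double commutation relation of `V` to `H'` and use that `t i j ⊗ I` is natural in the
Hilbert space (`ProductSystem.swap_amp`). With the corners `A⁽ⁱ⁾ = J* Ṽ⁽ⁱ⁾ (I ⊗ Q)` this gives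
(`CovRep.IsMultiAnalytic.doubly_commute_defect`)
`W̃⁽ʲ⁾* W̃⁽ⁱ⁾ - (I ⊗ W̃⁽ⁱ⁾) (t i j ⊗ I) (I ⊗ W̃⁽ʲ⁾*) = (I ⊗ A⁽ⁱ⁾) (t i j ⊗ I) (I ⊗ A⁽ʲ⁾*)`.
If `Q = P_K`, then the defect operator `(I ⊗ P_K) - T̃⁽ⁱ⁾* T̃⁽ⁱ⁾` equals `A⁽ⁱ⁾* A⁽ⁱ⁾`, because `Ṽ⁽ⁱ⁾` is
an isometry (`CovRep.IsQuotientSubspace.defect_eq`). Since `A* A X = 0` forces `A X = 0`, and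
`X A* A = 0` forces `X A* = 0`, the right-hand side vanishes exactly when the product of the defect
operators does (`CovRep.IsMultiAnalytic.doubly_commute_iff`).

If `K` is a Beurling quotient subspace, this applies to the given `W` and `J = M`. Conversely, `Kᗮ`
is invariant under `V` for every quotient subspace `K`, and it applies to the restriction of `V` to
`Kᗮ` (`CovRep.restrict`) and the inclusion `J` of `Kᗮ` into `H`.
-/

universe w

/-! ### Calculus of intertwiners -/

namespace Intertwiner

variable {B H₁ H₂ H₃ H₄ : Type*} [NonUnitalCStarAlgebra B]
  [NormedAddCommGroup H₁] [InnerProductSpace ℂ H₁] [CompleteSpace H₁]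
  [NormedAddCommGroup H₂] [InnerProductSpace ℂ H₂] [CompleteSpace H₂]
  [NormedAddCommGroup H₃] [InnerProductSpace ℂ H₃] [CompleteSpace H₃]
  [NormedAddCommGroup H₄] [InnerProductSpace ℂ H₄] [CompleteSpace H₄]
  {σ₁ : HilbertRep B H₁} {σ₂ : HilbertRep B H₂} {σ₃ : HilbertRep B H₃} {σ₄ : HilbertRep B H₄}

theorem ext_apply {X Y : Intertwiner σ₁ σ₂} (h : ∀ x, X.1 x = Y.1 x) : X = Y :=
  Subtype.ext (ContinuousLinearMap.ext h)

theorem comp_assoc (Z : Intertwiner σ₃ σ₄) (Y : Intertwiner σ₂ σ₃) (X : Intertwiner σ₁ σ₂) :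
    comp (comp Z Y) X = comp Z (comp Y X) := rfl

theorem one_comp (X : Intertwiner σ₁ σ₂) : comp (one σ₂) X = X := rfl

theorem comp_one (X : Intertwiner σ₁ σ₂) : comp X (one σ₁) = X := rfl

theorem zero_comp (X : Intertwiner σ₁ σ₂) : comp (0 : Intertwiner σ₂ σ₃) X = 0 := rfl

theorem comp_zero (Y : Intertwiner σ₂ σ₃) : comp Y (0 : Intertwiner σ₁ σ₂) = 0 :=
  ext_apply fun _ => map_zero Y.1

theorem sub_comp (Y Y' : Intertwiner σ₂ σ₃) (X : Intertwiner σ₁ σ₂) :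
    comp (Y - Y') X = comp Y X - comp Y' X := rfl

theorem comp_sub (Y : Intertwiner σ₂ σ₃) (X X' : Intertwiner σ₁ σ₂) :
    comp Y (X - X') = comp Y X - comp Y X' :=
  ext_apply fun x => map_sub Y.1 (X.1 x) (X'.1 x)

theorem adj_adj (X : Intertwiner σ₁ σ₂) : adj (adj X) = X :=
  Subtype.ext (ContinuousLinearMap.adjoint_adjoint X.1)

theorem adj_comp (Y : Intertwiner σ₂ σ₃) (X : Intertwiner σ₁ σ₂) :
    adj (comp Y X) = comp (adj X) (adj Y) :=
  Subtype.ext (ContinuousLinearMap.adjoint_comp Y.1 X.1)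

theorem adj_zero : adj (0 : Intertwiner σ₁ σ₂) = 0 :=
  Subtype.ext (map_zero ContinuousLinearMap.adjoint)

theorem adj_one : adj (one σ₁) = one σ₁ :=
  Subtype.ext ContinuousLinearMap.adjoint_id

theorem inner_adj_left (X : Intertwiner σ₁ σ₂) (x : H₁) (y : H₂) :
    inner ℂ ((adj X).1 y) x = inner ℂ y (X.1 x) :=
  ContinuousLinearMap.adjoint_inner_left X.1 x y

theorem inner_adj_right (X : Intertwiner σ₁ σ₂) (x : H₁) (y : H₂) :
    inner ℂ x ((adj X).1 y) = inner ℂ (X.1 x) y :=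
  ContinuousLinearMap.adjoint_inner_right X.1 x y

theorem isometry_iff (X : Intertwiner σ₁ σ₂) : Isometry X.1 ↔ comp (adj X) X = one σ₁ := by
  rw [AddMonoidHomClass.isometry_iff_norm, ContinuousLinearMap.norm_map_iff_adjoint_comp_self]
  exact ⟨fun h => Subtype.ext h, congrArg Subtype.val⟩

/-- `A*A` and `A` have the same kernel. -/
theorem comp_eq_zero_of_adj_comp {A : Intertwiner σ₂ σ₃} {X : Intertwiner σ₁ σ₂}
    (h : comp (comp (adj A) A) X = 0) : comp A X = 0 := by
  refine ext_apply fun x => ?_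
  have h1 : (adj A).1 (A.1 (X.1 x)) = 0 := DFunLike.congr_fun (Subtype.ext_iff.mp h) x
  change A.1 (X.1 x) = 0
  rw [← inner_self_eq_zero (𝕜 := ℂ), ← inner_adj_left, h1, inner_zero_left]

theorem comp_adj_eq_zero_of_comp {A : Intertwiner σ₁ σ₃} {X : Intertwiner σ₁ σ₂}
    (h : comp X (comp (adj A) A) = 0) : comp X (adj A) = 0 := by
  have h1 := congrArg adj h
  rw [adj_comp, adj_comp, adj_adj, adj_zero] at h1
  have h2 := congrArg adj (comp_eq_zero_of_adj_comp h1)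
  rwa [adj_comp, adj_adj, adj_zero] at h2

theorem norm_apply_le_of_idempotent {X : Intertwiner σ₁ σ₁} (hs : adj X = X)
    (hX : comp X X = X) (x : H₁) : ‖X.1 x‖ ≤ ‖x‖ := by
  have h : ‖X.1 x‖ ^ 2 ≤ ‖X.1 x‖ * ‖x‖ := by
    have h1 : inner ℂ (X.1 x) (X.1 x) = inner ℂ (X.1 x) x := by
      rw [← inner_adj_left, hs]
      exact congrArg (inner ℂ · x) (DFunLike.congr_fun (Subtype.ext_iff.mp hX) x)
    have h2 := congrArg norm h1
    rw [inner_self_eq_norm_sq_to_K, norm_pow, RCLike.norm_ofReal, abs_norm] at h2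
    exact h2.trans_le (norm_inner_le_norm _ _)
  rcases (norm_nonneg (X.1 x)).eq_or_lt' with h0 | h0
  · exact h0 ▸ norm_nonneg x
  · rw [pow_two] at h; exact le_of_mul_le_mul_left h h0

end Intertwiner

/-! ### Functoriality of interior tensor products -/

namespace Corr

open Intertwiner

variable {A B D E F H₁ H₂ H₃ : Type*} [NonUnitalCStarAlgebra A]
  [NonUnitalCStarAlgebra B] [PartialOrder B] [StarOrderedRing B]
  [NonUnitalCStarAlgebra D] [PartialOrder D] [StarOrderedRing D]
  [NormedAddCommGroup E] [NormedSpace ℂ E] [NormedAddCommGroup F] [NormedSpace ℂ F]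
  [NormedAddCommGroup H₁] [InnerProductSpace ℂ H₁] [CompleteSpace H₁]
  [NormedAddCommGroup H₂] [InnerProductSpace ℂ H₂] [CompleteSpace H₂]
  [NormedAddCommGroup H₃] [InnerProductSpace ℂ H₃] [CompleteSpace H₃]

section

variable {C : Corr A B E} {σ₁ : HilbertRep B H₁} {σ₂ : HilbertRep B H₂} {σ₃ : HilbertRep B H₃}

/-- Bounded operators on `E ⊗_σ H` are determined by their values on elementary tensors. -/
theorem clm_ext {Y : Type*} [NormedAddCommGroup Y] [NormedSpace ℂ Y]
    {f g : C.HTensor σ₁ →L[ℂ] Y} (h : ∀ ξ x, f (C.htmul σ₁ ξ x) = g (C.htmul σ₁ ξ x)) : f = g :=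
  (C.pre σ₁).ext_clm fun u => by
    induction u with
    | zero => simp
    | add u v hu hv => simp only [map_add, hu, hv]
    | tmul ξ x => exact h ξ x

theorem amp_comp (Y : Intertwiner σ₂ σ₃) (X : Intertwiner σ₁ σ₂) :
    C.amp (comp Y X) = comp (C.amp Y) (C.amp X) := by
  refine Subtype.ext (clm_ext fun ξ x => ?_)
  change _ = (C.amp Y).1 ((C.amp X).1 _)
  rw [amp_htmul, amp_htmul, amp_htmul]
  rfl

theorem amp_one : C.amp (one σ₁) = one (C.ind σ₁) :=
  Subtype.ext (clm_ext fun ξ x => C.amp_htmul _ ξ x)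

theorem amp_sub (X Y : Intertwiner σ₁ σ₂) : C.amp (X - Y) = C.amp X - C.amp Y := by
  refine Subtype.ext (clm_ext fun ξ x => ?_)
  change _ = (C.amp X).1 _ - (C.amp Y).1 _
  rw [amp_htmul, amp_htmul, amp_htmul, ← map_sub]
  rfl

/-- Adjointness is checked on elementary tensors, in one variable at a time; for these it says that
`X` intertwines `σ₁(⟨ξ, η⟩)` and `σ₂(⟨ξ, η⟩)`. -/
theorem amp_adj (X : Intertwiner σ₁ σ₂) : C.amp (adj X) = adj (C.amp X) := by
  refine Subtype.ext ((ContinuousLinearMap.eq_adjoint_iff _ _).mpr fun z w => ?_)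
  have key : ∀ ξ x, (innerSL ℂ ((C.amp (adj X)).1 (C.htmul σ₂ ξ x)))
      = (innerSL ℂ (C.htmul σ₂ ξ x)) ∘L (C.amp X).1 := fun ξ x => by
    refine clm_ext fun η y => ?_
    simp only [innerSL_apply_apply, ContinuousLinearMap.comp_apply]
    rw [amp_htmul, amp_htmul, inner_htmul, inner_htmul, inner_adj_left, X.apply_rep]
  have key2 : (innerSL ℂ w) ∘L (C.amp (adj X)).1 = innerSL ℂ ((C.amp X).1 w) := by
    refine clm_ext fun ξ x => ?_
    have h := congrArg (starRingEnd ℂ) (DFunLike.congr_fun (key ξ x) w)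
    simpa only [innerSL_apply_apply, ContinuousLinearMap.comp_apply, inner_conj_symm] using h
  have h := congrArg (starRingEnd ℂ) (DFunLike.congr_fun key2 z)
  simpa only [innerSL_apply_apply, ContinuousLinearMap.comp_apply, inner_conj_symm] using h

end

/-- The canonical unitary `(E ⊗ F) ⊗ H → E ⊗ (F ⊗ H)` is natural in `H`. -/
theorem assoc_amp (C : Corr A B E) (C' : Corr B D F) {σ₁ : HilbertRep D H₁}
    {σ₂ : HilbertRep D H₂} (X : Intertwiner σ₁ σ₂) :
    comp (C.assoc C' σ₂) ((C.tensor C').amp X)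
      = comp (C.amp (C'.amp X)) (C.assoc C' σ₁) := by
  refine Subtype.ext (clm_ext fun z x => ?_)
  simp only [comp, ContinuousLinearMap.comp_apply]
  rw [amp_htmul]
  revert z
  refine PreCorr.induction_emb _ (isClosed_eq ?_ ?_) fun u => ?_
  · have := C.continuous_assocBilin C' σ₂ (X.1 x)
    refine this.congr fun z => ?_
    exact (PreCorr.lift_emb _ (C.bound_assoc C' σ₂) (z ⊗ₜ X.1 x)).symm
  · have := (C.amp (C'.amp X)).1.continuous.comp (C.continuous_assocBilin C' σ₁ x)
    refine this.congr fun z => ?_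
    exact congrArg _ (PreCorr.lift_emb _ (C.bound_assoc C' σ₁) (z ⊗ₜ x)).symm
  · induction u with
    | zero => simp
    | add u v hu hv => simp only [map_add, LinearMap.add_apply, hu, hv]
    | tmul ξ η =>
      change (C.assoc C' σ₂).1 ((C.tensor C').htmul σ₂ (C.tmul C' ξ η) (X.1 x))
        = (C.amp (C'.amp X)).1 ((C.assoc C' σ₁).1 ((C.tensor C').htmul σ₁ (C.tmul C' ξ η) x))
      rw [assoc_htmul, assoc_htmul, amp_htmul, amp_htmul]

theorem adj_assoc_amp (C : Corr A B E) (C' : Corr B D F) {σ₁ : HilbertRep D H₁}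
    {σ₂ : HilbertRep D H₂} (X : Intertwiner σ₁ σ₂) :
    comp (adj (C.assoc C' σ₂)) (C.amp (C'.amp X))
      = comp ((C.tensor C').amp X) (adj (C.assoc C' σ₁)) := by
  have h := congrArg adj (C.assoc_amp C' (adj X))
  simp only [adj_comp, amp_adj, adj_adj] at h
  exact h.symm

end Corr

theorem CorrIso.amp_amp {A D E F H₁ H₂ : Type*} [NonUnitalCStarAlgebra A]
    [NonUnitalCStarAlgebra D] [PartialOrder D] [StarOrderedRing D]
    [NormedAddCommGroup E] [NormedSpace ℂ E] [NormedAddCommGroup F] [NormedSpace ℂ F]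
    [NormedAddCommGroup H₁] [InnerProductSpace ℂ H₁] [CompleteSpace H₁]
    [NormedAddCommGroup H₂] [InnerProductSpace ℂ H₂] [CompleteSpace H₂]
    {C : Corr A D E} {C' : Corr A D F} (U : CorrIso C C') {σ₁ : HilbertRep D H₁}
    {σ₂ : HilbertRep D H₂} (X : Intertwiner σ₁ σ₂) :
    Intertwiner.comp (U.amp σ₂) (C.amp X) = Intertwiner.comp (C'.amp X) (U.amp σ₁) := by
  refine Subtype.ext (Corr.clm_ext fun ξ x => ?_)
  simp only [Intertwiner.comp, ContinuousLinearMap.comp_apply]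
  rw [Corr.amp_htmul, CorrIso.amp_htmul, CorrIso.amp_htmul, Corr.amp_htmul]

namespace ProductSystem

open Intertwiner

variable {B : Type*} [NonUnitalCStarAlgebra B] [PartialOrder B] [StarOrderedRing B]
  {k : ℕ} {E : Fin k → Type*} [∀ i, NormedAddCommGroup (E i)] [∀ i, NormedSpace ℂ (E i)]
  [∀ i, CompleteSpace (E i)] (𝔼 : ProductSystem B E)
  {H₁ H₂ : Type*} [NormedAddCommGroup H₁] [InnerProductSpace ℂ H₁] [CompleteSpace H₁]
  [NormedAddCommGroup H₂] [InnerProductSpace ℂ H₂] [CompleteSpace H₂]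

/-- The operators `t i j ⊗ I_H` are natural in the represented Hilbert space `H`. -/
theorem swap_amp (i j : Fin k) {σ₁ : HilbertRep B H₁} {σ₂ : HilbertRep B H₂}
    (X : Intertwiner σ₁ σ₂) :
    comp (𝔼.swap i j σ₂) ((𝔼.corr i).amp ((𝔼.corr j).amp X))
      = comp ((𝔼.corr j).amp ((𝔼.corr i).amp X)) (𝔼.swap i j σ₁) := by
  rw [swap, swap, comp_assoc, comp_assoc, Corr.adj_assoc_amp, ← comp_assoc ((𝔼.t i j).amp σ₂),
    CorrIso.amp_amp, comp_assoc, ← comp_assoc _ (((𝔼.corr j).tensor (𝔼.corr i)).amp X),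
    Corr.assoc_amp, comp_assoc]

end ProductSystem

/-! ### Isometric multi-analytic operators -/

namespace CovRep

open Intertwiner

variable {B : Type*} [NonUnitalCStarAlgebra B] [PartialOrder B] [StarOrderedRing B]
  {k : ℕ} {E : Fin k → Type*} [∀ i, NormedAddCommGroup (E i)] [∀ i, NormedSpace ℂ (E i)]
  [∀ i, CompleteSpace (E i)] {𝔼 : ProductSystem B E}
  {H : Type w} [NormedAddCommGroup H] [InnerProductSpace ℂ H] [CompleteSpace H]
  {H' : Type w} [NormedAddCommGroup H'] [InnerProductSpace ℂ H'] [CompleteSpace H']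
  {V : CovRep 𝔼 H} {W : CovRep 𝔼 H'} {J : Intertwiner W.σ V.σ}

/-- The intertwiner underlying a multi-analytic operator. -/
noncomputable def IsMultiAnalytic.intertwiner {M : H' →L[ℂ] H} (hM : IsMultiAnalytic W V M) :
    Intertwiner W.σ V.σ :=
  ⟨M, fun a => ContinuousLinearMap.ext (hM.map_rep a)⟩

theorem IsMultiAnalytic.tilde_comp_amp (hJ : IsMultiAnalytic W V J.1) (i : Fin k) :
    comp (V.tilde i) ((𝔼.corr i).amp J) = comp J (W.tilde i) := by
  refine Subtype.ext (Corr.clm_ext fun ξ x => ?_)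
  simp only [comp, ContinuousLinearMap.comp_apply]
  rw [Corr.amp_htmul, CovRepOn.tilde_htmul, CovRepOn.tilde_htmul, hJ.map_V]

theorem IsMultiAnalytic.tilde_eq (hJ : IsMultiAnalytic W V J.1) (h1 : comp (adj J) J = one W.σ)
    (i : Fin k) :
    W.tilde i = comp (adj J) (comp (V.tilde i) ((𝔼.corr i).amp J)) := by
  rw [hJ.tilde_comp_amp, ← comp_assoc, h1, one_comp]

theorem IsMultiAnalytic.isometry_tilde (hJ : IsMultiAnalytic W V J.1)
    (h1 : comp (adj J) J = one W.σ) (i : Fin k) (hV : Isometry (V.tilde i).1) :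
    Isometry (W.tilde i).1 := by
  rw [isometry_iff] at hV ⊢
  calc comp (adj (W.tilde i)) (W.tilde i)
      = comp (adj (W.tilde i)) (comp (comp (adj J) J) (W.tilde i)) := by rw [h1, one_comp]
    _ = comp (adj (comp J (W.tilde i))) (comp J (W.tilde i)) := by rw [adj_comp]; rfl
    _ = comp (adj ((𝔼.corr i).amp J)) (comp (comp (adj (V.tilde i)) (V.tilde i))
          ((𝔼.corr i).amp J)) := by rw [← hJ.tilde_comp_amp, adj_comp]; rfl
    _ = one _ := by rw [hV, one_comp, ← Corr.amp_adj, ← Corr.amp_comp, h1, Corr.amp_one]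

/-- Compressing the double commutation relation of `V` along `J` leaves, as the defect of the
double commutation relation of `W`, the operator built from the corners
`J* Ṽ⁽ⁱ⁾ (I ⊗ Q)` with `Q = I - J J*`. -/
theorem IsMultiAnalytic.doubly_commute_defect (hJ : IsMultiAnalytic W V J.1)
    (h1 : comp (adj J) J = one W.σ) {Q : Intertwiner V.σ V.σ} (hQ : Q = one V.σ - comp J (adj J))
    (hQa : adj Q = Q) (hQQ : comp Q Q = Q) {i j : Fin k}
    (hV : comp (adj (V.tilde j)) (V.tilde i)
      = comp ((𝔼.corr j).amp (V.tilde i))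
          (comp (𝔼.swap i j V.σ) ((𝔼.corr i).amp (adj (V.tilde j))))) :
    comp ((𝔼.corr j).amp (comp (adj J) (comp (V.tilde i) ((𝔼.corr i).amp Q))))
      (comp (𝔼.swap i j V.σ)
        ((𝔼.corr i).amp (adj (comp (adj J) (comp (V.tilde j) ((𝔼.corr j).amp Q))))))
      = comp (adj (W.tilde j)) (W.tilde i) - comp ((𝔼.corr j).amp (W.tilde i))
          (comp (𝔼.swap i j W.σ) ((𝔼.corr i).amp (adj (W.tilde j)))) := by
  have e1 : comp (adj (W.tilde j)) (W.tilde i)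
      = comp (adj ((𝔼.corr j).amp J))
          (comp (comp (adj (V.tilde j)) (V.tilde i)) ((𝔼.corr i).amp J)) := by
    calc _ = comp (adj ((𝔼.corr j).amp J)) (comp (adj (V.tilde j)) (comp J (W.tilde i))) := by
            rw [hJ.tilde_eq h1 j, adj_comp, adj_comp, adj_adj]; rfl
      _ = _ := by rw [← hJ.tilde_comp_amp]; rfl
  set X : Intertwiner ((𝔼.corr i).ind W.σ) ((𝔼.corr i).ind ((𝔼.corr j).ind V.σ)) :=
    (𝔼.corr i).amp (comp (adj (V.tilde j)) J)
  set Y : Intertwiner ((𝔼.corr j).ind ((𝔼.corr i).ind V.σ)) ((𝔼.corr j).ind W.σ) :=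
    (𝔼.corr j).amp (comp (adj J) (V.tilde i))
  have a1 : comp (adj (W.tilde j)) (W.tilde i) = comp Y (comp (𝔼.swap i j V.σ) X) := by
    rw [e1, hV, ← Corr.amp_adj]
    simp only [X, Y, Corr.amp_comp]
    rfl
  have a2 : comp ((𝔼.corr j).amp (W.tilde i))
          (comp (𝔼.swap i j W.σ) ((𝔼.corr i).amp (adj (W.tilde j))))
      = comp Y (comp (𝔼.swap i j V.σ)
          (comp ((𝔼.corr i).amp ((𝔼.corr j).amp (comp J (adj J)))) X)) := by
    have hW : (𝔼.corr j).amp (W.tilde i) = comp Y ((𝔼.corr j).amp ((𝔼.corr i).amp J)) := by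
      rw [hJ.tilde_eq h1 i, ← comp_assoc, Corr.amp_comp]
    have hW' : (𝔼.corr i).amp (adj (W.tilde j))
        = comp ((𝔼.corr i).amp ((𝔼.corr j).amp (adj J))) X := by
      rw [hJ.tilde_eq h1 j, adj_comp, adj_comp, adj_adj, comp_assoc, ← Corr.amp_adj, Corr.amp_comp]
    rw [hW, hW', comp_assoc, ← comp_assoc _ (𝔼.swap i j W.σ), ← 𝔼.swap_amp, Corr.amp_comp,
      Corr.amp_comp]
    rfl
  have a3 : comp ((𝔼.corr j).amp (comp (adj J) (comp (V.tilde i) ((𝔼.corr i).amp Q))))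
      (comp (𝔼.swap i j V.σ)
        ((𝔼.corr i).amp (adj (comp (adj J) (comp (V.tilde j) ((𝔼.corr j).amp Q))))))
      = comp Y (comp (𝔼.swap i j V.σ) (comp ((𝔼.corr i).amp ((𝔼.corr j).amp Q)) X)) := by
    have hA : (𝔼.corr j).amp (comp (adj J) (comp (V.tilde i) ((𝔼.corr i).amp Q)))
        = comp Y ((𝔼.corr j).amp ((𝔼.corr i).amp Q)) := by
      rw [← comp_assoc, Corr.amp_comp]
    have hA' : (𝔼.corr i).amp (adj (comp (adj J) (comp (V.tilde j) ((𝔼.corr j).amp Q))))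
        = comp ((𝔼.corr i).amp ((𝔼.corr j).amp Q)) X := by
      rw [adj_comp, adj_comp, adj_adj, comp_assoc, ← Corr.amp_adj, hQa, Corr.amp_comp]
    have hI : comp ((𝔼.corr i).amp ((𝔼.corr j).amp Q)) ((𝔼.corr i).amp ((𝔼.corr j).amp Q))
        = (𝔼.corr i).amp ((𝔼.corr j).amp Q) := by
      rw [← Corr.amp_comp, ← Corr.amp_comp, hQQ]
    rw [hA, hA', comp_assoc, ← comp_assoc _ (𝔼.swap i j V.σ), ← 𝔼.swap_amp, comp_assoc,
      ← comp_assoc _ _ X, hI]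
  -- The three terms are `Y (t i j ⊗ I) (I ⊗ I ⊗ Z) X` for `Z = Q`, `Z = I` and `Z = J J*`.
  rw [a1, a2, a3, hQ, Corr.amp_sub, Corr.amp_sub, Corr.amp_one, Corr.amp_one, sub_comp, comp_sub,
    comp_sub]
  rfl

/-! ### Purity -/

theorem cpMap_comp_adj (hJ : IsMultiAnalytic W V J.1) (i : Fin k) (X : Intertwiner W.σ W.σ) :
    (V.V i).cpMap (comp J (comp X (adj J))) = comp J (comp ((W.V i).cpMap X) (adj J)) := by
  have h := congrArg adj (hJ.tilde_comp_amp i)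
  rw [adj_comp, adj_comp, ← Corr.amp_adj] at h
  calc _ = comp (comp (V.tilde i) ((𝔼.corr i).amp J)) (comp ((𝔼.corr i).amp X)
          (comp ((𝔼.corr i).amp (adj J)) (adj (V.tilde i)))) := by
        rw [CovRepOn.cpMap, Corr.amp_comp, Corr.amp_comp]; rfl
    _ = _ := by rw [hJ.tilde_comp_amp, h]; rfl

theorem cpMap_iterate_comp_adj (hJ : IsMultiAnalytic W V J.1) (i : Fin k)
    (X : Intertwiner W.σ W.σ) (n : ℕ) :
    (V.V i).cpMap^[n] (comp J (comp X (adj J))) = comp J (comp ((W.V i).cpMap^[n] X) (adj J)) := by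
  induction n with
  | zero => rfl
  | succ n ih => rw [Function.iterate_succ_apply', ih, cpMap_comp_adj hJ,
      Function.iterate_succ_apply']

theorem cpMap_adj (i : Fin k) (X : Intertwiner V.σ V.σ) :
    adj ((V.V i).cpMap X) = (V.V i).cpMap (adj X) := by
  rw [CovRepOn.cpMap, CovRepOn.cpMap, adj_comp, adj_comp, adj_adj, Corr.amp_adj, comp_assoc]

/-- The completely positive map of an isometric representation is multiplicative. -/
theorem cpMap_comp {i : Fin k} (hV : Isometry (V.tilde i).1) (X Y : Intertwiner V.σ V.σ) :
    comp ((V.V i).cpMap X) ((V.V i).cpMap Y) = (V.V i).cpMap (comp X Y) := by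
  rw [isometry_iff] at hV
  calc _ = comp (V.tilde i) (comp ((𝔼.corr i).amp X) (comp (comp (adj (V.tilde i)) (V.tilde i))
          (comp ((𝔼.corr i).amp Y) (adj (V.tilde i))))) := rfl
    _ = _ := by rw [hV, one_comp, CovRepOn.cpMap, Corr.amp_comp, comp_assoc]

theorem cpMap_iterate_adj (i : Fin k) (X : Intertwiner V.σ V.σ) (n : ℕ) :
    adj ((V.V i).cpMap^[n] X) = (V.V i).cpMap^[n] (adj X) := by
  induction n with
  | zero => rfl
  | succ n ih => rw [Function.iterate_succ_apply', Function.iterate_succ_apply', cpMap_adj, ih]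

theorem cpMap_iterate_comp {i : Fin k} (hV : Isometry (V.tilde i).1) (X Y : Intertwiner V.σ V.σ)
    (n : ℕ) :
    comp ((V.V i).cpMap^[n] X) ((V.V i).cpMap^[n] Y) = (V.V i).cpMap^[n] (comp X Y) := by
  induction n with
  | zero => rfl
  | succ n ih => simp only [Function.iterate_succ_apply', cpMap_comp hV, ih]

/-- A representation that embeds isometrically into a pure isometric one is pure: with
`P = J J*`, the projection `Φⁿ(P)` is dominated by `Φⁿ(I)`. -/
theorem IsMultiAnalytic.isPure (hJ : IsMultiAnalytic W V J.1) (h1 : comp (adj J) J = one W.σ)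
    (hV : ∀ i, Isometry (V.tilde i).1) (hp : V.IsPure) : W.IsPure := by
  intro i x
  have hW := hJ.isometry_tilde h1 i (hV i)
  set S := fun n : ℕ => (W.V i).cpMap^[n] (one W.σ)
  set T := fun n : ℕ => (V.V i).cpMap^[n] (one V.σ)
  have hS : ∀ n, S n = comp (S n) (comp (adj J) (comp (T n) J)) := fun n => by
    have h2 : comp (comp J (comp (S n) (adj J))) (T n) = comp J (comp (S n) (adj J)) := by
      rw [← cpMap_iterate_comp_adj hJ, one_comp, cpMap_iterate_comp (hV i), comp_one]
    have h3 := congrArg (fun Z => comp (adj J) (comp Z J)) h2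
    have h4 : ∀ Z : Intertwiner W.σ W.σ,
        comp (adj J) (comp (comp J (comp Z (adj J))) J) = Z := fun Z => by
      change comp (comp (adj J) J) (comp Z (comp (adj J) J)) = Z
      rw [h1, one_comp, comp_one]
    simp only [h4] at h3
    calc S n = comp (adj J) (comp (comp (comp J (comp (S n) (adj J))) (T n)) J) := h3.symm
      _ = comp (comp (adj J) J) (comp (S n) (comp (adj J) (comp (T n) J))) := rfl
      _ = _ := by rw [h1, one_comp]
  have hb : ∀ n, ‖(S n).1 x‖ ≤ ‖(adj J).1 ((T n).1 (J.1 x))‖ := fun n => by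
    rw [DFunLike.congr_fun (Subtype.ext_iff.mp (hS n)) x]
    refine norm_apply_le_of_idempotent (X := S n) ?_ ?_ _
    · rw [cpMap_iterate_adj, adj_one]
    · rw [cpMap_iterate_comp hW, one_comp]
  have ht : Filter.Tendsto (fun n => (adj J).1 ((T n).1 (J.1 x))) Filter.atTop (nhds 0) := by
    have := ((adj J).1.continuous.tendsto 0).comp (hp i (J.1 x))
    rwa [map_zero] at this
  exact squeeze_zero_norm hb (tendsto_zero_iff_norm_tendsto_zero.mp ht)

/-! ### Defect operators of a quotient subspace -/

variable {K : ClosedSubmodule ℂ H}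

theorem IsQuotientSubspace.adj_proj (hK : V.IsQuotientSubspace K) : adj hK.proj = hK.proj :=
  Subtype.ext (isSelfAdjoint_starProjection K.toSubmodule).adjoint_eq

theorem IsQuotientSubspace.proj_comp_proj (hK : V.IsQuotientSubspace K) :
    comp hK.proj hK.proj = hK.proj :=
  Subtype.ext K.toSubmodule.isIdempotentElem_starProjection

/-- The defect operator is `A* A` for the corner `A = J* Ṽ⁽ⁱ⁾ (I ⊗ P_K)`, where `J J* = I - P_K`. -/
theorem IsQuotientSubspace.defect_eq (hK : V.IsQuotientSubspace K)
    (hQ : hK.proj = one V.σ - comp J (adj J)) {i : Fin k} (hV : Isometry (V.tilde i).1) :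
    hK.defect i = comp (adj (comp (adj J) (comp (V.tilde i) ((𝔼.corr i).amp hK.proj))))
      (comp (adj J) (comp (V.tilde i) ((𝔼.corr i).amp hK.proj))) := by
  rw [isometry_iff] at hV
  set A := comp (V.tilde i) ((𝔼.corr i).amp hK.proj) with hA
  have hAA : comp (adj A) A = (𝔼.corr i).amp hK.proj := by
    calc comp (adj A) A = comp ((𝔼.corr i).amp (adj hK.proj))
          (comp (comp (adj (V.tilde i)) (V.tilde i)) ((𝔼.corr i).amp hK.proj)) := by
          rw [hA, adj_comp, Corr.amp_adj]; rfl
      _ = _ := by rw [hV, one_comp, ← Corr.amp_comp, hK.adj_proj, hK.proj_comp_proj]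
  have hc : comp (adj (hK.compression i)) (hK.compression i)
      = comp (adj A) (comp (comp hK.proj hK.proj) A) := by
    rw [compression, adj_comp, hK.adj_proj]; rfl
  rw [defect, hc, hK.proj_comp_proj, hQ, sub_comp, one_comp, comp_sub, ← hQ, hAA, sub_sub_cancel,
    adj_comp (adj J) A, adj_adj]
  rfl

/-- For an isometric multi-analytic operator `J` with `K = (J H')ᗮ`, double commutation of `W` is
the vanishing of the products of defect operators of `K`: the defect operators are `A⁽ⁱ⁾* A⁽ⁱ⁾` for
the corners `A⁽ⁱ⁾ = J* Ṽ⁽ⁱ⁾ (I ⊗ P_K)`, and the outer factors `A⁽ⁱ⁾*` and `A⁽ʲ⁾` can be cancelled. -/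
theorem IsMultiAnalytic.doubly_commute_iff (hJ : IsMultiAnalytic W V J.1)
    (h1 : comp (adj J) J = one W.σ) (hV : V.IsDoublyCommutingIsometric)
    (hK : V.IsQuotientSubspace K) (hQ : hK.proj = one V.σ - comp J (adj J)) {i j : Fin k}
    (hij : i ≠ j) :
    comp (adj (W.tilde j)) (W.tilde i) = comp ((𝔼.corr j).amp (W.tilde i))
          (comp (𝔼.swap i j W.σ) ((𝔼.corr i).amp (adj (W.tilde j))))
      ↔ comp ((𝔼.corr j).amp (hK.defect i))
          (comp (𝔼.swap i j V.σ) ((𝔼.corr i).amp (hK.defect j))) = 0 := by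
  rw [← sub_eq_zero, ← hJ.doubly_commute_defect h1 hQ hK.adj_proj hK.proj_comp_proj
    (hV.doubly_commute i j hij), hK.defect_eq hQ (hV.isometry i), hK.defect_eq hQ (hV.isometry j)]
  generalize comp (adj J) (comp (V.tilde i) ((𝔼.corr i).amp hK.proj)) = A
  generalize comp (adj J) (comp (V.tilde j) ((𝔼.corr j).amp hK.proj)) = A'
  rw [Corr.amp_comp, Corr.amp_comp, Corr.amp_adj, Corr.amp_adj]
  constructor
  · intro h
    calc _ = comp (adj ((𝔼.corr j).amp A)) (comp (comp ((𝔼.corr j).amp A)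
          (comp (𝔼.swap i j V.σ) (adj ((𝔼.corr i).amp A')))) ((𝔼.corr i).amp A')) := rfl
      _ = 0 := by rw [h, zero_comp, comp_zero]
  · intro h
    have h2 := comp_eq_zero_of_adj_comp h
    exact comp_adj_eq_zero_of_comp (X := comp ((𝔼.corr j).amp A) (𝔼.swap i j V.σ)) h2

theorem IsQuotientSubspace.proj_eq (hK : V.IsQuotientSubspace K) (h1 : comp (adj J) J = one W.σ)
    (hKJ : K.toSubmodule = (J.1.range)ᗮ) : hK.proj = one V.σ - comp J (adj J) := by
  refine ext_apply fun x => ?_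
  change K.toSubmodule.starProjection x = x - J.1 ((adj J).1 x)
  refine Submodule.eq_starProjection_of_mem_of_inner_eq_zero ?_ fun z hz => ?_
  · rw [hKJ, Submodule.mem_orthogonal]
    rintro _ ⟨y, rfl⟩
    have h2 : (adj J).1 (J.1 y) = y := DFunLike.congr_fun (Subtype.ext_iff.mp h1) y
    change inner ℂ (J.1 y) (x - J.1 ((adj J).1 x)) = 0
    rw [inner_sub_right, ← inner_adj_left J ((adj J).1 x) (J.1 y), h2, inner_adj_right, sub_self]
  · rw [hKJ, Submodule.mem_orthogonal] at hz
    rw [sub_sub_cancel]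
    exact hz _ ⟨_, rfl⟩

end CovRep

/-! ### Restriction to a closed invariant subspace -/

/-- The restriction of a representation to a closed invariant subspace. -/
noncomputable def restrictRep {B H : Type*} [NonUnitalCStarAlgebra B] [NormedAddCommGroup H]
    [InnerProductSpace ℂ H] [CompleteSpace H] (σ : HilbertRep B H) (S : Submodule ℂ H)
    [CompleteSpace S] (hS : ∀ b, ∀ x ∈ S, σ b x ∈ S) : HilbertRep B S where
  toFun b := (σ b ∘L S.subtypeL).codRestrict S fun x => hS b x x.2
  map_smul' c b := by ext x; exact DFunLike.congr_fun (map_smul σ c b) (x : H)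
  map_zero' := by ext x; exact DFunLike.congr_fun (map_zero σ) (x : H)
  map_add' a b := by ext x; exact DFunLike.congr_fun (map_add σ a b) (x : H)
  map_mul' a b := by ext x; exact DFunLike.congr_fun (map_mul σ a b) (x : H)
  map_star' b := by
    rw [ContinuousLinearMap.star_eq_adjoint, ContinuousLinearMap.eq_adjoint_iff]
    intro x y
    change inner ℂ (σ (star b) x) (y : H) = inner ℂ (x : H) (σ b y)
    rw [map_star, ContinuousLinearMap.star_eq_adjoint, ContinuousLinearMap.adjoint_inner_left]

namespace CovRep

open Intertwiner

variable {B : Type*} [NonUnitalCStarAlgebra B] [PartialOrder B] [StarOrderedRing B]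
  {k : ℕ} {E : Fin k → Type*} [∀ i, NormedAddCommGroup (E i)] [∀ i, NormedSpace ℂ (E i)]
  [∀ i, CompleteSpace (E i)] {𝔼 : ProductSystem B E}
  {H : Type w} [NormedAddCommGroup H] [InnerProductSpace ℂ H] [CompleteSpace H]
  {V : CovRep 𝔼 H}

section

variable (S : Submodule ℂ H) [CompleteSpace S] (hσ : ∀ b, ∀ x ∈ S, V.σ b x ∈ S)
  (hS : ∀ i ξ, ∀ x ∈ S, (V.V i).toLinearMap ξ x ∈ S)

/-- The inclusion of a closed invariant subspace, as an intertwiner. -/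
noncomputable def subtypeIntertwiner : Intertwiner (restrictRep V.σ S hσ) V.σ :=
  ⟨S.subtypeL, fun _ => rfl⟩

/-- The restriction of one component of a covariant representation to a closed invariant
subspace. -/
noncomputable def restrictOn (i : Fin k) : CovRepOn (𝔼.corr i) (restrictRep V.σ S hσ) where
  toLinearMap :=
    { toFun := fun ξ =>
        ((V.V i).toLinearMap ξ ∘L S.subtypeL).codRestrict S fun x => hS i ξ x x.2
      map_add' := fun ξ η => by
        ext x; exact DFunLike.congr_fun (map_add (V.V i).toLinearMap ξ η) (x : H)
      map_smul' := fun c ξ => by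
        ext x; exact DFunLike.congr_fun (map_smul (V.V i).toLinearMap c ξ) (x : H) }
  map_left a ξ := ContinuousLinearMap.ext fun x =>
    Subtype.ext (DFunLike.congr_fun ((V.V i).map_left a ξ) (x : H))
  map_right b ξ := ContinuousLinearMap.ext fun x =>
    Subtype.ext (DFunLike.congr_fun ((V.V i).map_right b ξ) (x : H))
  bounded := by
    -- On `E i ⊗ S` the map is the restriction of `Ṽ⁽ⁱ⁾ (I ⊗ J)`, for the inclusion `J` of `S`.
    set J := subtypeIntertwiner (V := V) S hσ
    refine ⟨‖(V.tilde i).1 ∘L ((𝔼.corr i).amp J).1‖, fun u => ?_⟩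
    refine le_trans (le_of_eq ?_) (ContinuousLinearMap.le_opNorm _ _)
    rw [← Submodule.norm_coe]
    congr 1
    induction u with
    | zero => simp
    | add u v hu hv => simp only [map_add, ← hu, ← hv, Submodule.coe_add]
    | tmul ξ x =>
      change _ = (V.tilde i).1 (((𝔼.corr i).amp J).1 ((𝔼.corr i).htmul _ ξ x))
      rw [Corr.amp_htmul, CovRepOn.tilde_htmul]
      rfl

theorem tilde_amp_subtype (i : Fin k) :
    comp (V.tilde i) ((𝔼.corr i).amp (subtypeIntertwiner S hσ))
      = comp (subtypeIntertwiner S hσ) (restrictOn S hσ hS i).tilde := by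
  refine Subtype.ext (Corr.clm_ext fun ξ x => ?_)
  simp only [comp, ContinuousLinearMap.comp_apply]
  rw [Corr.amp_htmul, CovRepOn.tilde_htmul, CovRepOn.tilde_htmul]
  rfl

/-- The restriction of a covariant representation to a closed invariant subspace. -/
noncomputable def restrict : CovRep 𝔼 S where
  σ := restrictRep V.σ S hσ
  V := restrictOn S hσ hS
  commute i j := by
    -- Both sides agree after composition with the (injective) inclusion `J` of `S`.
    set J := subtypeIntertwiner (V := V) S hσ
    have hJ := tilde_amp_subtype S hσ hS
    have hJJ : ∀ i j, comp J (comp (restrictOn S hσ hS i).tilde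
          ((𝔼.corr i).amp (restrictOn S hσ hS j).tilde))
        = comp (comp (V.tilde i) ((𝔼.corr i).amp (V.tilde j)))
            ((𝔼.corr i).amp ((𝔼.corr j).amp J)) := fun i j => by
      rw [← comp_assoc, ← hJ, comp_assoc, ← Corr.amp_comp, ← hJ, Corr.amp_comp, comp_assoc]
    have h : comp J (comp (restrictOn S hσ hS i).tilde
          ((𝔼.corr i).amp (restrictOn S hσ hS j).tilde))
        = comp J (comp (restrictOn S hσ hS j).tilde
          (comp ((𝔼.corr j).amp (restrictOn S hσ hS i).tilde) (𝔼.swap i j _))) := by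
      rw [← comp_assoc (restrictOn S hσ hS j).tilde, ← comp_assoc J _ (𝔼.swap i j _), hJJ, hJJ,
        V.commute, comp_assoc, comp_assoc, comp_assoc, comp_assoc, 𝔼.swap_amp]
    exact ext_apply fun x => Subtype.ext (DFunLike.congr_fun (Subtype.ext_iff.mp h) x)

end

variable {K : ClosedSubmodule ℂ H}

theorem IsQuotientSubspace.rep_mem_orthogonal (hK : V.IsQuotientSubspace K) (b : B) (x : H)
    (hx : x ∈ K.toSubmoduleᗮ) : V.σ b x ∈ K.toSubmoduleᗮ := by
  refine (Submodule.mem_orthogonal _ _).mpr fun u hu => ?_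
  have h := (Submodule.mem_orthogonal _ _).mp hx _ (hK.rep_mem (star b) u hu)
  rwa [map_star, ContinuousLinearMap.star_eq_adjoint, ContinuousLinearMap.adjoint_inner_left] at h

/-- Since `Ṽ⁽ⁱ⁾* K ⊆ E i ⊗ K` and `E i ⊗ Kᗮ` is orthogonal to `E i ⊗ K`, the complement `Kᗮ` is
invariant under `V⁽ⁱ⁾`. -/
theorem IsQuotientSubspace.map_mem_orthogonal (hK : V.IsQuotientSubspace K) (i : Fin k) (ξ : E i)
    (x : H) (hx : x ∈ K.toSubmoduleᗮ) : (V.V i).toLinearMap ξ x ∈ K.toSubmoduleᗮ := by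
  refine (Submodule.mem_orthogonal _ _).mpr fun u hu => ?_
  rw [← CovRepOn.tilde_htmul, ← inner_adj_left]
  have hle : V.tensorSubspace i K.toSubmodule ≤ (ℂ ∙ (𝔼.corr i).htmul V.σ ξ x)ᗮ := by
    refine Submodule.topologicalClosure_minimal _ (Submodule.span_le.mpr ?_)
      (Submodule.isClosed_orthogonal _)
    rintro _ ⟨η, y, hy, rfl⟩
    rw [SetLike.mem_coe, Submodule.mem_orthogonal_singleton_iff_inner_right, Corr.inner_htmul]
    exact (Submodule.mem_orthogonal' _ _).mp hx _ (hK.rep_mem _ y hy)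
  exact Submodule.mem_orthogonal_singleton_iff_inner_left.mp (hle (hK.adj_mem i u hu))

end CovRep

/-! ### Characterization of Beurling quotient subspaces -/

theorem mainTheorem1 {B : Type*} [NonUnitalCStarAlgebra B] [PartialOrder B] [StarOrderedRing B]
    {k : ℕ} {E : Fin k → Type*} [∀ i, NormedAddCommGroup (E i)] [∀ i, NormedSpace ℂ (E i)]
    [∀ i, CompleteSpace (E i)] (𝔼 : ProductSystem B E)
    {H : Type*} [NormedAddCommGroup H] [InnerProductSpace ℂ H] [CompleteSpace H]
    (V : CovRep 𝔼 H) (hV : V.IsDoublyCommutingIsometric) (hp : V.IsPure)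
    (K : ClosedSubmodule ℂ H) (hK : V.IsQuotientSubspace K) :
    V.IsBeurlingQuotientSubspace K ↔
      ∀ i j, i ≠ j →
        Intertwiner.comp ((𝔼.corr j).amp (hK.defect i))
          (Intertwiner.comp (𝔼.swap i j V.σ) ((𝔼.corr i).amp (hK.defect j))) = 0 := by
  constructor
  · rintro ⟨H', _, _, _, W, M, hW, -, hM, hiso, hKM⟩ i j hij
    have h1 := (Intertwiner.isometry_iff hM.intertwiner).mp hiso
    exact (CovRep.IsMultiAnalytic.doubly_commute_iff (J := hM.intertwiner) hM h1 hV hK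
      (hK.proj_eq h1 hKM) hij).mp (hW.doubly_commute i j hij)
  · -- Take for `W` the restriction of `V` to `Kᗮ`, and for `M` the inclusion.
    intro h
    let S := K.toSubmoduleᗮ
    let W := CovRep.restrict S hK.rep_mem_orthogonal hK.map_mem_orthogonal
    let J : Intertwiner W.σ V.σ := CovRep.subtypeIntertwiner S hK.rep_mem_orthogonal
    have hJ : CovRep.IsMultiAnalytic W V J.1 := ⟨fun _ _ _ => rfl, fun _ _ => rfl⟩
    have hiso : Isometry J.1 := S.subtypeₗᵢ.isometry
    have h1 := (Intertwiner.isometry_iff J).mp hiso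
    have hKJ : K.toSubmodule = (J.1.range)ᗮ := by
      have hr : J.1.range = S := S.range_subtype
      rw [hr]
      exact K.toSubmodule.orthogonal_orthogonal.symm
    exact ⟨S, inferInstance, inferInstance, inferInstance, W, J.1,
      ⟨fun i => hJ.isometry_tilde h1 i (hV.isometry i), fun i j hij =>
        (hJ.doubly_commute_iff h1 hV hK (hK.proj_eq h1 hKJ) hij).mpr (h i j hij)⟩,
      hJ.isPure h1 hV.isometry hp, hJ, hiso, hKJ⟩
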